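/- For a finite simple graph $G=(V,E)$ put one qubit on each vertex, and let $X_u, Z_u$ be the Pauli operators on qubit $u$. Let $\mathfrak g_G$ be the real Lie algebra (under the matrix commutator) generated by $\mathrm i\sum_{u\in V}X_u$ and $\mathrm i\sum_{(u,v)\in E}Z_uZ_v$ (the QAOA-MaxCut dynamical Lie algebra, DLA), and let $\mathfrak g_{G,\mathrm{ma}}$ be the real Lie algebra generated by all $\mathrm iX_u$ ($u\in V$) and all $\mathrm iZ_uZ_v$ ($(u,v)\in E$). The DLA of $G$ is called free if $\mathfrak g_G=\mathfrak g_{G,\mathrm{ma}}$. For an integer $N\ge 1$ the recursive algorithm CheckFreeDLA$(G,N)$ is the following. (1) If $|V|\le N$, decide by brute force whether the DLA of $G$ is free, and return true if it is and false otherwise. (2) Otherwise let $V_o$ and $V_e$ be the sets of vertices of odd and even degree in $G$. If $|V_o|<4$ or $|V_e|<4$, return false. (3) If CheckFreeDLA$(G[V_o],N)$ returns true, then return true if $\mathcal N(u)\cap V_o\ne\mathcal N(v)\cap V_o$ for all distinct $u,v\in V_e$, and false otherwise. (4) If CheckFreeDLA$(G[V_o],N)$ returns false but CheckFreeDLA$(G[V_e],N)$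 returns true, then return true if $\mathcal N(u)\cap V_e\ne\mathcal N(v)\cap V_e$ for all distinct $u,v\in V_o$, and false otherwise. (5) In the remaining case return false. Then the following hold. (i) For every finite simple graph $G$ and every $N\ge 1$, if CheckFreeDLA$(G,N)$ returns true, then the DLA of $G$ is free. (ii) There are constants $N\ge 1$ and $c>0$ such that for all $n\ge 7$ and $G\sim G(n,\tfrac12)$ (the Erdős–Rényi random graph on $n$ labelled vertices), CheckFreeDLA$(G,N)$ returns true with probability at least $1-\exp(-cn)$. In particular, for all $n\ge 7$ the DLA of $G\sim G(n,\tfrac12)$ is free with probability at least $1-\exp(-cn)$. -/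

import Mathlib

open Matrix MeasureTheory

/-- The single-qubit Pauli operator `X`. -/
def pauliX : Matrix (Fin 2) (Fin 2) ℂ := !![0, 1; 1, 0]

/-- The single-qubit Pauli operator `Z`. -/
def pauliZ : Matrix (Fin 2) (Fin 2) ℂ := !![1, 0; 0, -1]

/-- Operators on one qubit per vertex, written in the computational basis `V → Fin 2`. -/
abbrev QubitOp (V : Type*) : Type _ := Matrix (V → Fin 2) (V → Fin 2) ℂ

/-- The tensor product `⨂ w, P w` of one single-qubit operator per vertex. -/
def tensorOp {V : Type*} [Fintype V] (P : V → Matrix (Fin 2) (Fin 2) ℂ) : QubitOp V :=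
  Matrix.of fun x y => ∏ w, P w (x w) (y w)

-- The Lie bracket on operators is the commutator.
attribute [local instance 100] LieRing.ofAssociativeRing

section DLA

variable {V : Type*} [Fintype V] [DecidableEq V]

/-- The Pauli string `X_u`: `X` on qubit `u`, identity elsewhere. -/
def opX (u : V) : QubitOp V := tensorOp fun w => if w = u then pauliX else 1

/-- The Pauli string `Z_u Z_v` of an unordered pair `e = {u, v}`: `Z` on the qubits in `e`,
identity elsewhere. -/
def opZZ (e : Sym2 V) : QubitOp V := tensorOp fun w => if w ∈ e then pauliZ else 1

/-- The mixer Hamiltonian `H_m = ∑_{u ∈ V} X_u`. -/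
def mixerH (V : Type*) [Fintype V] [DecidableEq V] : QubitOp V := ∑ u : V, opX u

open Classical in
/-- The problem Hamiltonian `H_p = ∑_{(u,v) ∈ E} Z_u Z_v` of an unweighted graph. -/
noncomputable def problemH (G : SimpleGraph V) : QubitOp V := ∑ e ∈ G.edgeFinset, opZZ e

/-- The standard QAOA-MaxCut dynamical Lie algebra: the real Lie algebra of operators, under the
commutator, generated by `i H_p` and `i H_m`. -/
noncomputable def standardDLA (G : SimpleGraph V) : LieSubalgebra ℝ (QubitOp V) :=
  LieSubalgebra.lieSpan ℝ (QubitOp V) {Complex.I • problemH G, Complex.I • mixerH V}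

/-- The multi-angle QAOA-MaxCut dynamical Lie algebra: the real Lie algebra generated by all
`i X_u` (for `u` a vertex) and all `i Z_u Z_v` (for `(u, v)` an edge). -/
noncomputable def multiAngleDLA (G : SimpleGraph V) : LieSubalgebra ℝ (QubitOp V) :=
  LieSubalgebra.lieSpan ℝ (QubitOp V)
    (Set.range (fun u : V => Complex.I • opX u) ∪
      (fun e : Sym2 V => Complex.I • opZZ e) '' G.edgeSet)

/-- The DLA of `G` is free if it equals the multi-angle DLA. -/
def HasFreeDLA (G : SimpleGraph V) : Prop := standardDLA G = multiAngleDLA G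

open Classical in
/-- The set `V_o` of odd-degree vertices. -/
noncomputable def oddVerts (G : SimpleGraph V) : Finset V := {u | Odd (G.degree u)}

open Classical in
/-- The set `V_e` of even-degree vertices. -/
noncomputable def evenVerts (G : SimpleGraph V) : Finset V := {u | Even (G.degree u)}

/-- The induced subgraph `G[S]`, as a graph with vertex set `S`. -/
def inducedOn (G : SimpleGraph V) (S : Finset V) : SimpleGraph {u // u ∈ S} :=
  G.comap Subtype.val

/-- Distinct vertices of `S` have distinct neighbourhoods in `T`. -/
def SeparatedBy (G : SimpleGraph V) (S T : Finset V) : Prop :=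
  ∀ u ∈ S, ∀ v ∈ S, u ≠ v → G.neighborSet u ∩ T ≠ G.neighborSet v ∩ T

end DLA

theorem card_oddVerts_add_card_evenVerts {V : Type*} [Fintype V] (G : SimpleGraph V) :
    (oddVerts G).card + (evenVerts G).card = Fintype.card V := by
  classical
  have h : evenVerts G = Finset.univ.filter fun u => ¬ Odd (G.degree u) := by
    ext u
    simp [evenVerts, Nat.not_odd_iff_even]
  rw [h, oddVerts, Finset.card_filter_add_card_filter_not, Finset.card_univ]

open Classical in
/-- The recursive algorithm `CheckFreeDLA(G, N)`. On at most `N` vertices it returns the outcome of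
the brute-force test whether the DLA of `G` is free. Otherwise it splits the vertices by degree
parity, gives up if either part has fewer than four vertices, recurses on `G[V_o]` (and, only if
that call returns `false`, on `G[V_e]`), and after a successful call returns `true` if the vertices
of the other part are told apart by their neighbourhoods in the part recursed on. -/
noncomputable def checkFreeDLA (N : ℕ) {V : Type*} [Fintype V] [DecidableEq V]
    (G : SimpleGraph V) : Bool :=
  if Fintype.card V ≤ N then decide (HasFreeDLA G)
  else if _h : (oddVerts G).card < 4 ∨ (evenVerts G).card < 4 then false
  else if checkFreeDLA N (inducedOn G (oddVerts G)) = true then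
    decide (SeparatedBy G (evenVerts G) (oddVerts G))
  else if checkFreeDLA N (inducedOn G (evenVerts G)) = true then
    decide (SeparatedBy G (oddVerts G) (evenVerts G))
  else false
termination_by Fintype.card V
decreasing_by
  all_goals
    have := card_oddVerts_add_card_evenVerts G
    simp only [Fintype.card_coe]
    omega

/-- The law of the Erdős–Rényi random graph `G(n, 1/2)` on `n` labelled vertices. -/
noncomputable def erHalf (n : ℕ) : Measure (SimpleGraph (Fin n)) :=
  SimpleGraph.binomialRandom (Fin n) ⟨1 / 2, by norm_num, by norm_num⟩

/-! Call a vertex set `A` a cell if `i ∑_{u ∈ A} X_u` lies in the standard DLA. Two operations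
refine cells. A polynomial in the squared adjoint action of a `ZZ`-sum keeps exactly the `X_u`
incident to an odd number of its terms (`sumX_filter_odd_mem`). A polynomial in the squared adjoint
action of a cell keeps exactly the `ZZ`-terms with one endpoint in that cell
(`sumZZ_filter_cut_mem`). Hence `V_o` and `V_e` are cells, and a cell splits by the parity of the
number of neighbours in a disjoint cell. If every singleton is a cell, the DLA is free.

Soundness: let `S` be a cell with `G[S]` free. The operators on `S` whose extension by the identity
lies in the DLA of `G` are stable under bracketing with both generators of `G[S]` and contain its
mixer, hence contain the derived algebra of its DLA. Freeness puts each `iZ_uZ_v` of `G[S]` in that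
derived algebra, so the whole DLA of `G[S]` embeds (`standardDLA_inducedOn_le_comap`). Vertices of
`S` become singleton cells, and their neighbourhoods isolate the remaining vertices when `S`
separates them.

Probability: under `G(n, 1/2)` this is counting. Fixing `V_o = S` still leaves `G[S]` and `G[Sᶜ]` as
good as independent and uniform, because the edges across the cut absorb the parity constraints.
Failure requires that both recursive calls fail or that one side does not separate the other; the
latter is rare, by a switching argument. With the inductive bound `exp(-c(k+1))` on parts of size
`k`, both calls fail with probability at most `exp(-c(n+2))`, and the spare factor `exp(-c)` pays
for the separation error. The base case only needs one free graph of each size `n ≥ 7`, supplied by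
a spider (`hasFreeDLA_spider`). -/

/-! ### Pauli strings: products, eigenvalues, matrix entries. -/

section TensorOperators

variable {V : Type*} [Fintype V] [DecidableEq V]

theorem tensorOp_mul (P Q : V → Matrix (Fin 2) (Fin 2) ℂ) :
    tensorOp P * tensorOp Q = tensorOp fun w => P w * Q w := by
  ext x y
  simp only [tensorOp, Matrix.mul_apply, Matrix.of_apply, ← Finset.prod_mul_distrib]
  rw [Finset.prod_univ_sum, Fintype.piFinset_univ]

omit [DecidableEq V] in
theorem tensorOp_one : tensorOp (fun _ : V => 1) = 1 := by
  ext x y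
  simp only [tensorOp, Matrix.of_apply, Matrix.one_apply]
  rw [Finset.prod_ite_zero]
  simp [funext_iff]

omit [DecidableEq V] in
theorem tensorOp_smul (c : V → ℂ) (P : V → Matrix (Fin 2) (Fin 2) ℂ) :
    tensorOp (fun w => c w • P w) = (∏ w, c w) • tensorOp P := by
  ext x y
  simp [tensorOp, Finset.prod_mul_distrib]

theorem pauliX_mul_self : pauliX * pauliX = 1 := by
  ext i j; fin_cases i <;> fin_cases j <;> simp [pauliX]

theorem pauliX_mul_pauliZ : pauliX * pauliZ = (-1 : ℂ) • (pauliZ * pauliX) := by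
  ext i j; fin_cases i <;> fin_cases j <;> simp [pauliX, pauliZ]

theorem opX_mul_self (u : V) : opX u * opX u = 1 := by
  rw [opX, tensorOp_mul, ← tensorOp_one]
  congr 1; ext1 w
  split_ifs <;> simp [pauliX_mul_self]

theorem opX_commute (u v : V) : Commute (opX u) (opX v) := by
  rw [Commute, SemiconjBy, opX, opX, tensorOp_mul, tensorOp_mul]
  congr 1; ext1 w
  split_ifs <;> simp

theorem opX_mul_opZZ_of_mem {u : V} {e : Sym2 V} (h : u ∈ e) :
    opX u * opZZ e = -(opZZ e * opX u) := by
  have key : (fun w => (if w = u then pauliX else 1) * (if w ∈ e then pauliZ else 1)) =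
      fun w => (if w = u then (-1 : ℂ) else 1) •
        ((if w ∈ e then pauliZ else 1) * (if w = u then pauliX else 1)) := by
    ext1 w
    by_cases hw : w = u
    · subst hw; simp [h, pauliX_mul_pauliZ]
    · simp [hw]
  rw [opX, opZZ, tensorOp_mul, tensorOp_mul, key, tensorOp_smul]
  simp

theorem opX_commute_opZZ {u : V} {e : Sym2 V} (h : u ∉ e) : Commute (opX u) (opZZ e) := by
  rw [Commute, SemiconjBy, opX, opZZ, tensorOp_mul, tensorOp_mul]
  congr 1; ext1 w
  by_cases hw : w = u
  · subst hw; simp [h]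
  · simp [hw]

/-- The sum of the operators `X_u` over a set of vertices. -/
def sumX (A : Finset V) : QubitOp V := ∑ u ∈ A, opX u

/-- The sum of the operators `Z_u Z_v` over a set of pairs. -/
def sumZZ (F : Finset (Sym2 V)) : QubitOp V := ∑ e ∈ F, opZZ e

/-- The eigenvalue of `Z_u Z_v` on a computational basis state. -/
def signZZ (e : Sym2 V) (x : V → Fin 2) : ℤ := ∏ w, if w ∈ e then (-1) ^ (x w : ℕ) else 1

theorem opZZ_eq_diagonal (e : Sym2 V) : opZZ e = diagonal fun x => (signZZ e x : ℂ) := by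
  have h1 : ∀ (w : V) (i j : Fin 2), (if w ∈ e then pauliZ else 1) i j =
      if i = j then ((if w ∈ e then (-1) ^ (i : ℕ) else 1 : ℤ) : ℂ) else 0 := by
    intro w i j
    split_ifs <;> fin_cases i <;> fin_cases j <;> simp_all [pauliZ]
  ext x y
  simp only [opZZ, tensorOp, Matrix.of_apply, h1, diagonal_apply, signZZ]
  rw [Finset.prod_ite_zero]
  simp [funext_iff]

theorem sumZZ_eq_diagonal (F : Finset (Sym2 V)) :
    sumZZ F = diagonal fun x => ((∑ e ∈ F, signZZ e x : ℤ) : ℂ) := by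
  ext x y
  simp only [sumZZ, opZZ_eq_diagonal, Matrix.sum_apply, diagonal_apply]
  split_ifs <;> simp

theorem signZZ_eq_or (e : Sym2 V) (x : V → Fin 2) : signZZ e x = 1 ∨ signZZ e x = -1 := by
  rw [signZZ]
  refine Finset.prod_induction _ (fun z : ℤ => z = 1 ∨ z = -1) ?_ (Or.inl rfl) ?_
  · rintro a b (rfl | rfl) (rfl | rfl) <;> simp
  · intro w _
    split_ifs
    · exact neg_one_pow_eq_or ℤ _
    · exact Or.inl rfl

/-- Flipping one bit of a computational basis state. -/
def flipBit (u : V) (x : V → Fin 2) : V → Fin 2 := Function.update x u (x u + 1)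

theorem opX_apply (u : V) (x y : V → Fin 2) :
    opX u x y = if y = flipBit u x then 1 else 0 := by
  have h1 : ∀ w : V, (if w = u then pauliX else 1) (x w) (y w) =
      if y w = flipBit u x w then 1 else 0 := by
    intro w
    by_cases hw : w = u
    · subst hw
      simp only [if_true, flipBit, Function.update_self]
      generalize x w = i
      generalize y w = j
      fin_cases i <;> fin_cases j <;> simp [pauliX]
    · simp [hw, flipBit, Matrix.one_apply, eq_comm]
  simp only [opX, tensorOp, Matrix.of_apply, h1]
  rw [Finset.prod_ite_zero]
  simp [funext_iff]

theorem signZZ_flipBit (e : Sym2 V) (u : V) (x : V → Fin 2) :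
    signZZ e (flipBit u x) = if u ∈ e then -signZZ e x else signZZ e x := by
  have h1 : ∀ w : V, (if w ∈ e then (-1 : ℤ) ^ (flipBit u x w : ℕ) else 1) =
      (if w = u ∧ u ∈ e then -1 else 1) * (if w ∈ e then (-1) ^ (x w : ℕ) else 1) := by
    intro w
    by_cases hw : w = u
    · subst hw
      by_cases he : w ∈ e
      · simp only [he, if_true, flipBit, Function.update_self, and_self]
        generalize x w = i
        fin_cases i <;> simp
      · simp [he]
    · simp [hw, flipBit]
  rw [signZZ, Finset.prod_congr rfl fun w _ => h1 w, Finset.prod_mul_distrib, ← signZZ]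
  by_cases he : u ∈ e <;> simp [he]

theorem sum_signZZ_sub_flipBit (F : Finset (Sym2 V)) (u : V) (x : V → Fin 2) :
    ∑ e ∈ F, signZZ e x - ∑ e ∈ F, signZZ e (flipBit u x) =
      2 * ∑ e ∈ F with u ∈ e, signZZ e x := by
  rw [← Finset.sum_sub_distrib, Finset.mul_sum, Finset.sum_filter]
  refine Finset.sum_congr rfl fun e _ => ?_
  rw [signZZ_flipBit]
  split_ifs <;> ring

/-- A sum of `F.card` signs has the parity of `F.card` and absolute value at most `F.card`. The
parity is thus visible in the square, and only finitely many squares can occur, so interpolation can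
detect it. -/
theorem exists_sum_signZZ_eq (F : Finset (Sym2 V)) (x : V → Fin 2) :
    ∃ k : ℕ, k ≤ F.card ∧ (∑ e ∈ F, signZZ e x) ^ 2 = (k : ℤ) ^ 2 ∧ (Odd k ↔ Odd F.card) := by
  refine ⟨(∑ e ∈ F, signZZ e x).natAbs, ?_, by simp, ?_⟩
  · have h : |∑ e ∈ F, signZZ e x| ≤ ∑ e ∈ F, (1 : ℤ) :=
      (Finset.abs_sum_le_sum_abs _ _).trans (Finset.sum_le_sum fun e _ => by
        rcases signZZ_eq_or e x with h | h <;> simp [h])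
    rw [Finset.sum_const, nsmul_one] at h
    zify
    exact h
  · rw [Int.natAbs_odd]
    induction F using Finset.induction_on with
    | empty => simp
    | insert e F he ih =>
      rw [Finset.sum_insert he, Finset.card_insert_of_notMem he]
      rcases signZZ_eq_or e x with h | h <;> rw [h] <;> grind

end TensorOperators

/-! ### Polynomials in an operator, and parity by interpolation. -/

theorem Submodule.aeval_mem_of_invariant {R M : Type*} [CommRing R] [AddCommGroup M] [Module R M]
    (p : Submodule R M) (T : M →ₗ[R] M) (hT : ∀ x ∈ p, T x ∈ p) (q : Polynomial R) {x : M}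
    (hx : x ∈ p) : Polynomial.aeval T q x ∈ p := by
  induction q using Polynomial.induction_on' with
  | add q r hq hr => rw [map_add, LinearMap.add_apply]; exact p.add_mem hq hr
  | monomial k a =>
    rw [Polynomial.aeval_monomial, ← Algebra.smul_def, LinearMap.smul_apply]
    refine p.smul_mem a ?_
    induction k with
    | zero => simpa using hx
    | succ k ih => rw [pow_succ']; exact hT _ ih

theorem Matrix.aeval_apply_of_entrywise {ι : Type*} (T : Matrix ι ι ℂ →ₗ[ℝ] Matrix ι ι ℂ)
    (τ : ι → ι → ℝ) (hT : ∀ M x y, T M x y = τ x y * M x y) (q : Polynomial ℝ)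
    (M : Matrix ι ι ℂ) (x y : ι) :
    Polynomial.aeval T q M x y = (q.eval (τ x y) : ℝ) * M x y := by
  induction q using Polynomial.induction_on' with
  | add q r hq hr =>
    rw [map_add, LinearMap.add_apply, Matrix.add_apply, hq, hr, Polynomial.eval_add]
    push_cast; ring
  | monomial k a =>
    rw [Polynomial.aeval_monomial, ← Algebra.smul_def, LinearMap.smul_apply,
      Polynomial.eval_monomial, Matrix.smul_apply]
    have h : ∀ k : ℕ, (T ^ k) M x y = (τ x y : ℂ) ^ k * M x y := by
      intro k
      induction k with
      | zero => simp
      | succ k ih => rw [pow_succ', Module.End.mul_apply, hT, ih]; ring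
    rw [h]
    push_cast
    rw [Complex.real_smul]; ring

/-- A polynomial taking the value `1` at `-4 k ^ 2` for odd `k ≤ n`, and `0` for even `k ≤ n`. -/
theorem exists_parity_polynomial (n : ℕ) : ∃ q : Polynomial ℝ, ∀ k ≤ n,
    q.eval (-(4 * (k : ℝ) ^ 2)) = if Odd k then 1 else 0 := by
  have hinj : Set.InjOn (fun k : ℕ => -(4 * (k : ℝ) ^ 2)) (Finset.range (n + 1)) := by
    intro a _ b _ hab
    have h : (a : ℝ) ^ 2 = (b : ℝ) ^ 2 := by simpa using hab
    exact_mod_cast (pow_left_inj₀ (Nat.cast_nonneg a) (Nat.cast_nonneg b) two_ne_zero).1 h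
  refine ⟨Lagrange.interpolate (Finset.range (n + 1)) (fun k : ℕ => -(4 * (k : ℝ) ^ 2))
    (fun k => if Odd k then 1 else 0), fun k hk => ?_⟩
  exact Lagrange.eval_interpolate_at_node _ hinj (by simp; omega)

/-! ### The two refinement operations inside a Lie algebra. -/

section Refinement

variable {V : Type*} [Fintype V] [DecidableEq V]

theorem sumX_apply (A : Finset V) (x y : V → Fin 2) :
    sumX A x y = ∑ u ∈ A, if y = flipBit u x then (1 : ℂ) else 0 := by
  simp [sumX, Matrix.sum_apply, opX_apply]

theorem lie_diagonal_apply {ι : Type*} [Fintype ι] [DecidableEq ι] (d : ι → ℂ)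
    (M : Matrix ι ι ℂ) (x y : ι) : ⁅diagonal d, M⁆ x y = (d x - d y) * M x y := by
  rw [LieRing.of_associative_ring_bracket, Matrix.sub_apply, Matrix.diagonal_mul,
    Matrix.mul_diagonal]
  ring

/-- The bracket with a diagonal matrix multiplies the entry at `(x, y)` by a difference of
eigenvalues. For `X_u` only the entries with `y = flipBit u x` matter, and there only the terms of
`F` at `u` change sign, so the difference is twice a sum of as many signs as there are such terms.
The interpolating polynomial reads off the parity of that number. -/
theorem sumX_filter_odd_mem {g : LieSubalgebra ℝ (QubitOp V)} {F : Finset (Sym2 V)}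
    {A : Finset V} (hF : Complex.I • sumZZ F ∈ g) (hA : Complex.I • sumX A ∈ g) :
    Complex.I • sumX {u ∈ A | Odd (Finset.card {e ∈ F | u ∈ e})} ∈ g := by
  obtain ⟨q, hq⟩ := exists_parity_polynomial F.card
  set D : QubitOp V := Complex.I • sumZZ F with hD
  -- The factor `i` makes a single bracket act by imaginary multipliers; squaring makes them real,
  -- so that real polynomials, which preserve a real Lie algebra, suffice.
  let T : QubitOp V →ₗ[ℝ] QubitOp V :=
    (LieAlgebra.ad ℝ (QubitOp V) D) ∘ₗ (LieAlgebra.ad ℝ (QubitOp V) D)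
  let τ : (V → Fin 2) → (V → Fin 2) → ℝ := fun x y =>
    -(((∑ e ∈ F, signZZ e x - ∑ e ∈ F, signZZ e y : ℤ) : ℝ) ^ 2)
  have hT : ∀ M x y, T M x y = τ x y * M x y := by
    intro M x y
    have hDd : D = diagonal fun x => Complex.I * ((∑ e ∈ F, signZZ e x : ℤ) : ℂ) := by
      rw [hD, sumZZ_eq_diagonal]
      ext x y
      simp [diagonal_apply]
    simp only [T, LinearMap.comp_apply, LieAlgebra.ad_apply, hDd, lie_diagonal_apply, τ]
    push_cast
    linear_combination ((∑ e ∈ F, (signZZ e x : ℂ) - ∑ e ∈ F, (signZZ e y : ℂ)) ^ 2 * M x y) *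
      Complex.I_sq
  have hmem : Polynomial.aeval T q (Complex.I • sumX A) ∈ g.toSubmodule :=
    Submodule.aeval_mem_of_invariant _ T
      (fun M hM => g.lie_mem hF (g.lie_mem hF hM)) q hA
  suffices h : Complex.I • sumX {u ∈ A | Odd (Finset.card {e ∈ F | u ∈ e})} =
      Polynomial.aeval T q (Complex.I • sumX A) from h ▸ hmem
  ext x y
  rw [Matrix.aeval_apply_of_entrywise T τ hT, Matrix.smul_apply, Matrix.smul_apply, sumX_apply,
    sumX_apply, Finset.sum_filter, smul_eq_mul, smul_eq_mul, mul_left_comm]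
  congr 1
  rw [Finset.mul_sum]
  refine Finset.sum_congr rfl fun u _ => ?_
  split_ifs with h1 h2 h2
  · subst h2
    obtain ⟨k, hk, hk2, hodd⟩ := exists_sum_signZZ_eq {e ∈ F | u ∈ e} x
    have hτ : τ x (flipBit u x) = -(4 * (k : ℝ) ^ 2) := by
      simp only [τ, sum_signZZ_sub_flipBit]
      have : ((∑ e ∈ F with u ∈ e, signZZ e x : ℤ) : ℝ) ^ 2 = (k : ℝ) ^ 2 := by exact_mod_cast hk2
      push_cast at this ⊢
      rw [mul_pow, this]; norm_num
    rw [hτ, hq k (hk.trans (Finset.card_filter_le _ _)), if_pos (hodd.2 h1)]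
    simp
  · simp
  · subst h2
    obtain ⟨k, hk, hk2, hodd⟩ := exists_sum_signZZ_eq {e ∈ F | u ∈ e} x
    have hτ : τ x (flipBit u x) = -(4 * (k : ℝ) ^ 2) := by
      simp only [τ, sum_signZZ_sub_flipBit]
      have : ((∑ e ∈ F with u ∈ e, signZZ e x : ℤ) : ℝ) ^ 2 = (k : ℝ) ^ 2 := by exact_mod_cast hk2
      push_cast at this ⊢
      rw [mul_pow, this]; norm_num
    rw [hτ, hq k (hk.trans (Finset.card_filter_le _ _)), if_neg (fun h => h1 (hodd.1 h))]
    simp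
  · simp

/-- How the commutator with a sum of commuting terms acts on an operator that
anticommutes with some of them and commutes with the rest. -/
theorem lie_add_mul_of_anticommute {R : Type*} [Ring R] {P Q f z : R} (hP : P * z = -(z * P))
    (hQ : Q * z = z * Q) (hPf : Commute P f) (hQf : Commute Q f) :
    ⁅P + Q, f * z⁆ = 2 * (P * f) * z := by
  have h1 : P * (f * z) = P * f * z := by rw [mul_assoc]
  have h2 : f * z * P = -(P * f * z) := by
    rw [mul_assoc, hPf.eq, mul_assoc, hP, mul_neg, neg_neg]
  have h3 : Q * (f * z) = f * z * Q := by
    rw [← mul_assoc, hQf.eq, mul_assoc, hQ, mul_assoc]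
  rw [LieRing.of_associative_ring_bracket, add_mul, mul_add, h1, h2, h3]
  noncomm_ring

theorem sumX_commute (A B : Finset V) : Commute (sumX A) (sumX B) :=
  Commute.sum_left _ _ _ fun u _ => Commute.sum_right _ _ _ fun v _ => opX_commute u v

theorem sumX_mul_opZZ_of_subset {A : Finset V} {e : Sym2 V} (h : ∀ u ∈ A, u ∈ e) :
    sumX A * opZZ e = -(opZZ e * sumX A) := by
  rw [sumX, Finset.sum_mul, Finset.mul_sum, ← Finset.sum_neg_distrib]
  exact Finset.sum_congr rfl fun u hu => opX_mul_opZZ_of_mem (h u hu)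

theorem sumX_commute_opZZ {A : Finset V} {e : Sym2 V} (h : ∀ u ∈ A, u ∉ e) :
    Commute (sumX A) (opZZ e) :=
  Commute.sum_left _ _ _ fun u hu => opX_commute_opZZ (h u hu)

/-- Only the `X_u` with `u ∈ e` survive. The factor `f` collects the `X`-polynomials produced by
earlier brackets, so the lemma can be iterated. -/
theorem lie_sumX_mul_opZZ (A : Finset V) (e : Sym2 V) {f : QubitOp V}
    (hf : ∀ B, Commute (sumX B) f) :
    ⁅sumX A, f * opZZ e⁆ = 2 * (sumX {u ∈ A | u ∈ e} * f) * opZZ e := by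
  have hA : sumX A = sumX {u ∈ A | u ∈ e} + sumX {u ∈ A | u ∉ e} :=
    (Finset.sum_filter_add_sum_filter_not _ _ _).symm
  rw [hA]
  exact lie_add_mul_of_anticommute (sumX_mul_opZZ_of_subset (by simp))
    (sumX_commute_opZZ (by simp)) (hf _) (hf _)

theorem lie_lie_sumX_opZZ (A : Finset V) (e : Sym2 V) :
    ⁅sumX A, ⁅sumX A, opZZ e⁆⁆ = 4 * sumX {u ∈ A | u ∈ e} ^ 2 * opZZ e := by
  have h1 := lie_sumX_mul_opZZ A e (f := 1) fun B => Commute.one_right _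
  have h2 := lie_sumX_mul_opZZ A e (f := 2 * sumX {u ∈ A | u ∈ e}) fun B =>
    ((Commute.ofNat_right _ 2).mul_right (sumX_commute _ _))
  rw [one_mul, mul_one] at h1
  rw [h1, h2]
  noncomm_ring

theorem lie_pow_four_sumX_opZZ (A : Finset V) (e : Sym2 V) :
    ⁅sumX A, ⁅sumX A, ⁅sumX A, ⁅sumX A, opZZ e⁆⁆⁆⁆ =
      16 * sumX {u ∈ A | u ∈ e} ^ 4 * opZZ e := by
  set P := sumX {u ∈ A | u ∈ e} with hP
  have hc : ∀ B (k : ℕ), Commute (sumX B) (P ^ k) := fun B k => (sumX_commute _ _).pow_right k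
  rw [lie_lie_sumX_opZZ,
    lie_sumX_mul_opZZ A e fun B => (Commute.ofNat_right _ 4).mul_right (hc B 2),
    lie_sumX_mul_opZZ A e fun B => (Commute.ofNat_right _ 2).mul_right
      ((sumX_commute _ _).mul_right ((Commute.ofNat_right _ 4).mul_right (hc B 2))), ← hP]
  noncomm_ring

/-- The polynomial `t⁴ - 4t²` vanishes at `0` and `±2` and equals `-3` at `±1`. A sum of no, one or
two commuting involutions has spectrum in `{0}`, `{±1}` or `{0, ±2}` respectively. -/
theorem sumX_pow_four_sub (A : Finset V) (e : Sym2 V) :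
    sumX {u ∈ A | u ∈ e} ^ 4 - 4 * sumX {u ∈ A | u ∈ e} ^ 2 =
      if Finset.card {u ∈ A | u ∈ e} = 1 then -3 else 0 := by
  have hle : Finset.card {u ∈ A | u ∈ e} ≤ 2 := by
    induction e with
    | _ a b =>
      refine (Finset.card_le_card (t := {a, b}) ?_).trans Finset.card_le_two
      intro u
      simp
  have hX : ∀ u : V, opX u ^ 2 = 1 := fun u => by rw [sq, opX_mul_self]
  interval_cases h : Finset.card {u ∈ A | u ∈ e}
  · rw [Finset.card_eq_zero] at h
    simp [h, sumX]
  · obtain ⟨a, ha⟩ := Finset.card_eq_one.1 h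
    have h4 : opX a ^ 4 = 1 := by rw [show 4 = 2 * 2 from rfl, pow_mul, hX, one_pow]
    simp only [ha, sumX, Finset.sum_singleton, hX, h4, if_true]
    norm_num
  · obtain ⟨a, b, hab, hs⟩ := Finset.card_eq_two.1 h
    have hsq : (opX a + opX b) ^ 2 = 2 + 2 * (opX a * opX b) := by
      rw [(opX_commute a b).add_sq, hX, hX]; grind
    have hab2 : (opX a * opX b) ^ 2 = 1 := by rw [(opX_commute a b).mul_pow, hX, hX, one_mul]
    have h4 : (opX a + opX b) ^ 4 = 4 * (opX a + opX b) ^ 2 := by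
      have h : ∀ y : QubitOp V, y ^ 2 = 1 → (2 + 2 * y) ^ 2 = 4 * (2 + 2 * y) := by
        intro y hy
        -- The operators form a noncommutative ring, so the identity is proved in `ℤ[X]` and
        -- evaluated at `y`.
        have h := congrArg (Polynomial.aeval y) (show ((2 + 2 * Polynomial.X) ^ 2 : Polynomial ℤ) =
          4 * (2 + 2 * Polynomial.X) + 4 * (Polynomial.X ^ 2 - 1) by ring)
        simpa only [map_pow, map_add, map_mul, map_sub, map_ofNat, map_one, Polynomial.aeval_X, hy,
          sub_self, mul_zero, add_zero] using h
      rw [show 4 = 2 * 2 from rfl, pow_mul, hsq]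
      exact h _ hab2
    simp only [hs, sumX, Finset.sum_pair hab, h4, sub_self]
    simp

/-- With `L = ad (sumX A)`, the operator `L⁴ - 16 L²` acts on `Z_uZ_v` as `16 (P⁴ - 4P²)`, where `P`
sums the `X` at the endpoints in `A`. This is `-48` on terms with one endpoint in `A` and zero on
the others. -/
theorem sumZZ_filter_cut_mem {g : LieSubalgebra ℝ (QubitOp V)} {F : Finset (Sym2 V)}
    {A : Finset V} (hF : Complex.I • sumZZ F ∈ g) (hA : Complex.I • sumX A ∈ g) :
    Complex.I • sumZZ {e ∈ F | Finset.card {u ∈ A | u ∈ e} = 1} ∈ g := by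
  set T := fun M : QubitOp V => ⁅Complex.I • sumX A, ⁅Complex.I • sumX A, M⁆⁆ with hT
  set L := LieAlgebra.ad ℂ (QubitOp V) (sumX A) with hL
  have hTg : ∀ M ∈ g, T M ∈ g := fun M hM => g.lie_mem hA (g.lie_mem hA hM)
  have key : Complex.I • sumZZ {e ∈ F | Finset.card {u ∈ A | u ∈ e} = 1} =
      (-(1 / 48) : ℝ) • (T (T (Complex.I • sumZZ F)) + (16 : ℝ) • T (Complex.I • sumZZ F)) := by
    have hTM : ∀ M : QubitOp V, T M = -L (L M) := by
      intro M
      simp only [hT, hL, LieAlgebra.ad_apply, smul_lie, lie_smul, smul_smul, Complex.I_mul_I,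
        neg_one_smul]
    have hz : ∀ e : Sym2 V, L (L (L (L (opZZ e)))) - (16 : ℝ) • L (L (opZZ e)) =
        if Finset.card {u ∈ A | u ∈ e} = 1 then (-48 : ℝ) • opZZ e else 0 := by
      intro e
      simp only [hL, LieAlgebra.ad_apply]
      rw [lie_pow_four_sumX_opZZ, lie_lie_sumX_opZZ]
      have h := congrArg (fun M => 16 * (M * opZZ e)) (sumX_pow_four_sub A e)
      rw [Algebra.smul_def, map_ofNat]
      refine Eq.trans ?_ (h.trans ?_)
      · noncomm_ring
      · split_ifs
        · rw [Algebra.smul_def, map_neg, map_ofNat]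
          noncomm_ring
        · simp
    have hsum : L (L (L (L (sumZZ F)))) - (16 : ℝ) • L (L (sumZZ F)) =
        (-48 : ℝ) • sumZZ {e ∈ F | Finset.card {u ∈ A | u ∈ e} = 1} := by
      simp only [sumZZ, map_sum, Finset.smul_sum, ← Finset.sum_sub_distrib, hz,
        Finset.sum_filter, smul_ite, smul_zero]
    have hsum2 : sumZZ {e ∈ F | Finset.card {u ∈ A | u ∈ e} = 1} =
        (-(1 / 48) : ℝ) • (L (L (L (L (sumZZ F)))) - (16 : ℝ) • L (L (sumZZ F))) := by
      rw [hsum, smul_smul]; norm_num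
    simp only [hTM, map_neg, map_smul, neg_neg]
    rw [hsum2, smul_comm, smul_sub, smul_neg, ← sub_eq_add_neg, smul_comm (16 : ℝ)]
  rw [key]
  exact g.smul_mem _ (g.add_mem (hTg _ (hTg _ hF)) (g.smul_mem _ (hTg _ hF)))

end Refinement

/-! ### Cells of the standard DLA and how they split. -/

section Splitting

variable {V : Type*} [Fintype V] [DecidableEq V]

/-- The partial mixer `i ∑_{u ∈ A} X_u` belongs to the standard DLA of `G`. -/
def IsMixerCell (G : SimpleGraph V) (A : Finset V) : Prop :=
  Complex.I • sumX A ∈ standardDLA G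

variable {G : SimpleGraph V} {A B : Finset V}

theorem isMixerCell_univ (G : SimpleGraph V) : IsMixerCell G Finset.univ :=
  LieSubalgebra.subset_lieSpan (Or.inr rfl)

open Classical in
theorem smul_sumZZ_edgeFinset_mem (G : SimpleGraph V) :
    Complex.I • sumZZ G.edgeFinset ∈ standardDLA G :=
  LieSubalgebra.subset_lieSpan (Or.inl rfl)

theorem IsMixerCell.sdiff (hA : IsMixerCell G A) (hB : IsMixerCell G B) (h : B ⊆ A) :
    IsMixerCell G (A \ B) := by
  have h1 : Complex.I • sumX (A \ B) = Complex.I • sumX A - Complex.I • sumX B := by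
    rw [← smul_sub, sumX, sumX, sumX, ← Finset.sum_sdiff h, add_sub_cancel_right]
  rw [IsMixerCell, h1]
  exact sub_mem hA hB

theorem IsMixerCell.compl (hA : IsMixerCell G A) : IsMixerCell G Aᶜ := by
  rw [Finset.compl_eq_univ_sdiff]
  exact (isMixerCell_univ G).sdiff hA (Finset.subset_univ _)

open Classical in
theorem isMixerCell_oddVerts (G : SimpleGraph V) : IsMixerCell G (oddVerts G) := by
  have h := sumX_filter_odd_mem (smul_sumZZ_edgeFinset_mem G) (isMixerCell_univ G)
  rw [IsMixerCell]
  refine (congrArg (fun A => Complex.I • sumX A ∈ standardDLA G) ?_).mp h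
  refine Finset.filter_congr fun u _ => ?_
  rw [← G.card_incidenceFinset_eq_degree, G.incidenceFinset_eq_filter]

theorem evenVerts_eq_compl (G : SimpleGraph V) : evenVerts G = (oddVerts G)ᶜ := by
  ext u; simp [evenVerts, oddVerts]

open Classical in
theorem isMixerCell_evenVerts (G : SimpleGraph V) : IsMixerCell G (evenVerts G) :=
  evenVerts_eq_compl G ▸ (isMixerCell_oddVerts G).compl

-- Cutting the edge set by `A` and then by the disjoint set `B` leaves exactly the edges between `A`
-- and `B`.
open Classical in
theorem card_filter_mem_cut (h : Disjoint A B) {u : V} (hu : u ∈ A) :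
    Finset.card {e ∈ {e ∈ {e ∈ G.edgeFinset | Finset.card {u ∈ A | u ∈ e} = 1} |
      Finset.card {u ∈ B | u ∈ e} = 1} | u ∈ e} = Finset.card {v ∈ B | G.Adj u v} := by
  rw [Finset.disjoint_left] at h
  rw [← Finset.card_image_of_injective (Finset.filter _ B) (f := fun v => s(u, v))
    (fun v w hvw => Sym2.congr_right.1 hvw)]
  congr 1
  ext e
  simp only [Finset.mem_filter, Finset.mem_image, SimpleGraph.mem_edgeFinset]
  constructor
  · rintro ⟨⟨⟨he, -⟩, hB⟩, hue⟩
    obtain ⟨v, rfl⟩ := Sym2.mem_iff_exists.1 hue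
    obtain ⟨w, hw⟩ := Finset.card_eq_one.1 hB
    have hw' : w ∈ Finset.filter (fun x => x ∈ s(u, v)) B := hw ▸ Finset.mem_singleton_self w
    rw [Finset.mem_filter, Sym2.mem_iff] at hw'
    rcases hw' with ⟨hwB, rfl | rfl⟩
    · exact absurd hwB (h hu)
    · exact ⟨w, ⟨hwB, he⟩, rfl⟩
  · rintro ⟨v, ⟨hv, huv⟩, rfl⟩
    refine ⟨⟨⟨huv, Finset.card_eq_one.2 ⟨u, ?_⟩⟩, Finset.card_eq_one.2 ⟨v, ?_⟩⟩, by simp⟩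
    · ext w
      simp only [Finset.mem_filter, Sym2.mem_iff, Finset.mem_singleton]
      constructor
      · rintro ⟨hw, rfl | rfl⟩
        · rfl
        · exact absurd hv (h hw)
      · rintro rfl; exact ⟨hu, Or.inl rfl⟩
    · ext w
      simp only [Finset.mem_filter, Sym2.mem_iff, Finset.mem_singleton]
      constructor
      · rintro ⟨hw, rfl | rfl⟩
        · exact absurd hw (h hu)
        · rfl
      · rintro rfl; exact ⟨hv, Or.inr rfl⟩

open Classical in
/-- A cell is refined by the parity of the number of neighbours in another cell. -/
theorem IsMixerCell.filter_odd (hA : IsMixerCell G A) (hB : IsMixerCell G B) (h : Disjoint A B) :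
    IsMixerCell G {u ∈ A | Odd (Finset.card {v ∈ B | G.Adj u v})} := by
  have h1 := sumX_filter_odd_mem
    (sumZZ_filter_cut_mem (sumZZ_filter_cut_mem (smul_sumZZ_edgeFinset_mem G) hA) hB) hA
  refine (congrArg (IsMixerCell G) ?_).mp h1
  refine Finset.filter_congr fun u hu => ?_
  rw [card_filter_mem_cut h hu]

open Classical in
theorem IsMixerCell.filter_adj {u : V} (hA : IsMixerCell G A) (hu : IsMixerCell G {u})
    (h : u ∉ A) : IsMixerCell G {v ∈ A | G.Adj u v} := by
  have h1 := hA.filter_odd hu (by simpa using h)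
  refine (congrArg (IsMixerCell G) ?_).mp h1
  refine Finset.filter_congr fun v _ => ?_
  rw [Finset.filter_singleton, G.adj_comm]
  split_ifs with hv <;> simp [hv]

open Classical in
theorem IsMixerCell.filter_not_adj {u : V} (hA : IsMixerCell G A) (hu : IsMixerCell G {u})
    (h : u ∉ A) : IsMixerCell G {v ∈ A | ¬ G.Adj u v} := by
  rw [Finset.filter_not]
  exact hA.sdiff (hA.filter_adj hu h) (Finset.filter_subset _ _)

open Classical in
theorem standardDLA_le_multiAngleDLA (G : SimpleGraph V) : standardDLA G ≤ multiAngleDLA G := by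
  rw [standardDLA, LieSubalgebra.lieSpan_le]
  rintro M (rfl | rfl)
  · rw [problemH, Finset.smul_sum]
    exact sum_mem fun e he => LieSubalgebra.subset_lieSpan
      (Or.inr ⟨e, SimpleGraph.mem_edgeFinset.1 he, rfl⟩)
  · rw [mixerH, Finset.smul_sum]
    exact sum_mem fun u _ => LieSubalgebra.subset_lieSpan (Or.inl ⟨u, rfl⟩)

/-- A graph whose vertices can all be isolated as cells has a free DLA. -/
theorem hasFreeDLA_of_isMixerCell_singleton (h : ∀ u, IsMixerCell G {u}) : HasFreeDLA G := by
  classical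
  refine le_antisymm (standardDLA_le_multiAngleDLA G) ?_
  rw [multiAngleDLA, LieSubalgebra.lieSpan_le]
  rintro M (⟨u, rfl⟩ | ⟨e, he, rfl⟩)
  · simpa [IsMixerCell, sumX] using h u
  · induction e with
    | _ u v =>
    have huv : u ≠ v := G.ne_of_adj he
    have h1 := sumZZ_filter_cut_mem (sumZZ_filter_cut_mem (smul_sumZZ_edgeFinset_mem G) (h u)) (h v)
    refine (congrArg (fun M => Complex.I • M ∈ standardDLA G) ?_).mp h1
    refine (congrArg sumZZ ?_).trans (Finset.sum_singleton opZZ s(u, v))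
    ext e
    simp only [Finset.mem_filter, SimpleGraph.mem_edgeFinset, Finset.filter_singleton,
      Finset.mem_singleton]
    constructor
    · rintro ⟨⟨-, h1⟩, h2⟩
      have hu : u ∈ e := by by_contra hu; simp [hu] at h1
      have hv : v ∈ e := by by_contra hv; simp [hv] at h2
      exact (Sym2.mem_and_mem_iff huv).1 ⟨hu, hv⟩
    · rintro rfl
      exact ⟨⟨he, by simp⟩, by simp⟩

/-- If the vertices of `S` are isolated as cells and tell all other vertices apart, then every
vertex is isolated. -/
theorem isMixerCell_singleton_of_separatedBy {S : Finset V} (hS : ∀ u ∈ S, IsMixerCell G {u})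
    (hSc : IsMixerCell G Sᶜ) (hsep : SeparatedBy G Sᶜ S) (w : V) : IsMixerCell G {w} := by
  classical
  by_cases hw : w ∈ S
  · exact hS w hw
  -- Each `u ∈ T` is a singleton cell and splits the current cell into its neighbours and
  -- non-neighbours; the half containing `w` is kept.
  have key : ∀ T ⊆ S, IsMixerCell G {v ∈ Sᶜ | ∀ u ∈ T, G.Adj u v ↔ G.Adj u w} := by
    intro T
    induction T using Finset.induction_on with
    | empty => intro _; simpa using hSc
    | insert u T hu ih =>
      intro hT
      have huS : u ∈ S := hT (Finset.mem_insert_self u T)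
      have h1 := ih fun x hx => hT (Finset.mem_insert_of_mem hx)
      by_cases huw : G.Adj u w
      · refine (congrArg (IsMixerCell G) ?_).mp (h1.filter_adj (hS u huS) (by simp [huS]))
        ext v; simp [huw]; tauto
      · refine (congrArg (IsMixerCell G) ?_).mp (h1.filter_not_adj (hS u huS) (by simp [huS]))
        ext v; simp [huw]; tauto
  refine (congrArg (IsMixerCell G) ?_).mpr (key S subset_rfl)
  ext v
  simp only [Finset.mem_singleton, Finset.mem_filter, Finset.mem_compl]
  constructor
  · rintro rfl; exact ⟨hw, fun u _ => Iff.rfl⟩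
  · rintro ⟨hv, hvw⟩
    by_contra hne
    refine hsep v (by simpa using hv) w (by simpa using hw) hne ?_
    ext u
    simp only [Set.mem_inter_iff, SimpleGraph.mem_neighborSet, Finset.mem_coe]
    rw [G.adj_comm v, G.adj_comm w]
    exact and_congr_left fun hu => hvw u hu

end Splitting

/-! ### An invariant subspace containing the derived algebra. -/

section Ideal

/-- `I` contains `a` but need not contain `b`. Stability under both generators gives stability under
the whole algebra (`h1`), and since `⁅a, b⁆ ∈ I` also `⁅y, b⁆ ∈ I` for every `y` (`h2`). Modulo `I`
the algebra is therefore spanned by `b`, and all brackets land in `I`. -/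
theorem lie_mem_of_mem_lieSpan_pair {R L : Type*} [CommRing R] [LieRing L] [LieAlgebra R L]
    {a b : L} {I : Submodule R L} (ha : a ∈ I) (haI : ∀ x ∈ I, ⁅a, x⁆ ∈ I)
    (hbI : ∀ x ∈ I, ⁅b, x⁆ ∈ I) {y z : L} (hy : y ∈ LieSubalgebra.lieSpan R L {a, b})
    (hz : z ∈ LieSubalgebra.lieSpan R L {a, b}) : ⁅y, z⁆ ∈ I := by
  have h1 : ∀ y ∈ LieSubalgebra.lieSpan R L {a, b}, ∀ x ∈ I, ⁅y, x⁆ ∈ I := by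
    intro y hy
    induction hy using LieSubalgebra.lieSpan_induction with
    | mem y hy => rcases hy with rfl | rfl; exacts [haI, hbI]
    | zero => intro x _; simp
    | smul r y _ ih => intro x hx; rw [smul_lie]; exact I.smul_mem r (ih x hx)
    | add y z _ _ ihy ihz => intro x hx; rw [add_lie]; exact I.add_mem (ihy x hx) (ihz x hx)
    | lie y z _ _ ihy ihz =>
      intro x hx
      rw [lie_lie]
      exact I.sub_mem (ihy _ (ihz _ hx)) (ihz _ (ihy _ hx))
  have h2 : ∀ y ∈ LieSubalgebra.lieSpan R L {a, b}, ⁅y, b⁆ ∈ I := by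
    intro y hy
    induction hy using LieSubalgebra.lieSpan_induction with
    | mem y hy =>
      rcases hy with rfl | rfl
      · rw [← lie_skew]; exact I.neg_mem (hbI _ ha)
      · simp
    | zero => simp
    | smul r y _ ih => rw [smul_lie]; exact I.smul_mem r ih
    | add y z _ _ ihy ihz => rw [add_lie]; exact I.add_mem ihy ihz
    | lie y z hy hz ihy ihz =>
      rw [lie_lie]
      exact I.sub_mem (h1 _ hy _ ihz) (h1 _ hz _ ihy)
  induction hz using LieSubalgebra.lieSpan_induction generalizing y with
  | mem z hz => rcases hz with rfl | rfl; exacts [h1 y hy _ ha, h2 y hy]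
  | zero => simp
  | smul r z _ ih => rw [lie_smul]; exact I.smul_mem r (ih hy)
  | add z w _ _ ihz ihw => rw [lie_add]; exact I.add_mem (ihz hy) (ihw hy)
  | lie z w hz hw ihz ihw =>
    rw [leibniz_lie]
    have h3 := ihz hy
    refine I.add_mem ?_ (h1 _ hz _ (ihw hy))
    rw [← lie_skew]
    exact I.neg_mem (h1 _ hw _ h3)

end Ideal

/-! ### Passing from a free induced subgraph to the whole graph. -/

section Induced

variable {V : Type*} [Fintype V] [DecidableEq V]

open scoped Kronecker in
/-- Extending an operator on the qubits in `S` by the identity on the other qubits. -/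
def extendOp (S : Finset V) : QubitOp {u // u ∈ S} →ₗ⁅ℝ⁆ QubitOp V where
  toFun M := (M ⊗ₖ (1 : QubitOp {u // u ∉ S})).submatrix
    (Equiv.piEquivPiSubtypeProd (· ∈ S) fun _ => Fin 2)
    (Equiv.piEquivPiSubtypeProd (· ∈ S) fun _ => Fin 2)
  map_add' M N := by rw [Matrix.add_kronecker]; rfl
  map_smul' r M := by rw [Matrix.smul_kronecker]; rfl
  map_lie' := by
    intro M N
    have h : ∀ M N : QubitOp {u // u ∈ S}, (M * N) ⊗ₖ (1 : QubitOp {u // u ∉ S}) =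
        (M ⊗ₖ (1 : QubitOp {u // u ∉ S})) * (N ⊗ₖ (1 : QubitOp {u // u ∉ S})) := by
      intro M N
      rw [← Matrix.mul_kronecker_mul, one_mul]
    simp only [LieRing.of_associative_ring_bracket, Matrix.submatrix_mul_equiv, ← h]
    ext x y
    simp only [Matrix.submatrix_apply, Matrix.sub_apply, Matrix.kroneckerMap_apply, sub_mul]

theorem extendOp_apply (S : Finset V) (M : QubitOp {u // u ∈ S}) (x y : V → Fin 2) :
    extendOp S M x y = M (fun u => x u) (fun u => y u) *
      (1 : QubitOp {u // u ∉ S}) (fun u => x u) (fun u => y u) := rfl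

theorem extendOp_smul (S : Finset V) (c : ℂ) (M : QubitOp {u // u ∈ S}) :
    extendOp S (c • M) = c • extendOp S M := by
  ext x y
  simp only [extendOp_apply, Matrix.smul_apply, smul_eq_mul, mul_assoc]

theorem extendOp_tensorOp (S : Finset V) (P : V → Matrix (Fin 2) (Fin 2) ℂ)
    (hP : ∀ w ∉ S, P w = 1) : extendOp S (tensorOp fun w => P w) = tensorOp P := by
  ext x y
  rw [extendOp_apply, ← tensorOp_one]
  simp only [tensorOp, Matrix.of_apply]
  rw [← Finset.prod_mul_prod_compl S,
    Finset.prod_subtype S (p := (· ∈ S)) (fun w => Iff.rfl) fun w => P w (x w) (y w),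
    Finset.prod_subtype Sᶜ (p := (· ∉ S)) (fun w => Finset.mem_compl) fun w => P w (x w) (y w)]
  congr 1
  exact Finset.prod_congr rfl fun w _ => by rw [hP w w.2]

theorem extendOp_opX (S : Finset V) (u : {u // u ∈ S}) : extendOp S (opX u) = opX (u : V) := by
  rw [opX, opX, ← extendOp_tensorOp S]
  · simp only [Subtype.ext_iff]
  · intro w hw
    rw [if_neg]
    rintro rfl
    exact hw u.2

theorem extendOp_opZZ (S : Finset V) (e : Sym2 {u // u ∈ S}) :
    extendOp S (opZZ e) = opZZ (e.map Subtype.val) := by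
  rw [opZZ, opZZ, ← extendOp_tensorOp S]
  · congr 2; ext1 w
    have : (w : V) ∈ e.map Subtype.val ↔ w ∈ e := by
      rw [Sym2.mem_map]
      exact ⟨fun ⟨a, ha, haw⟩ => Subtype.ext haw ▸ ha, fun h => ⟨w, h, rfl⟩⟩
    simp only [this]
  · intro w hw
    rw [if_neg]
    rw [Sym2.mem_map]
    rintro ⟨a, -, rfl⟩
    exact hw a.2

theorem extendOp_mixerH (S : Finset V) : extendOp S (mixerH {u // u ∈ S}) = sumX S := by
  rw [mixerH, map_sum, sumX, ← Finset.sum_coe_sort S]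
  exact Finset.sum_congr rfl fun u _ => extendOp_opX S u

open Classical in
theorem extendOp_problemH (G : SimpleGraph V) (S : Finset V) :
    extendOp S (problemH (inducedOn G S)) = sumZZ {e ∈ G.edgeFinset | ∀ u ∈ e, u ∈ S} := by
  have h : ({e ∈ G.edgeFinset | ∀ u ∈ e, u ∈ S} : Finset (Sym2 V)) =
      (inducedOn G S).edgeFinset.image (Sym2.map Subtype.val) := by
    ext e
    simp only [Finset.mem_filter, Finset.mem_image, SimpleGraph.mem_edgeFinset]
    constructor
    · induction e with
      | _ a b =>
      rintro ⟨hab, hS⟩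
      exact ⟨s(⟨a, hS a (by simp)⟩, ⟨b, hS b (by simp)⟩), hab, rfl⟩
    · rintro ⟨e, he, rfl⟩
      induction e with
      | _ a b => exact ⟨he, by simp⟩
  rw [problemH, map_sum, h, sumZZ,
    Finset.sum_image fun a _ b _ hab => Sym2.map.injective Subtype.val_injective hab]
  exact Finset.sum_congr rfl fun e _ => extendOp_opZZ S e

theorem lie_opZZ_extendOp {S : Finset V} {e : Sym2 V} (he : ∀ u ∈ e, u ∉ S)
    (M : QubitOp {u // u ∈ S}) : ⁅opZZ e, extendOp S M⁆ = 0 := by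
  ext x y
  rw [opZZ_eq_diagonal, lie_diagonal_apply, extendOp_apply, Matrix.zero_apply]
  by_cases hxy : (fun u : {u // u ∉ S} => x u) = fun u : {u // u ∉ S} => y u
  · have : signZZ e x = signZZ e y := by
      refine Finset.prod_congr rfl fun w _ => ?_
      split_ifs with hw
      · rw [show x w = y w from congrFun hxy ⟨w, he w hw⟩]
      · rfl
    rw [this, sub_self, zero_mul]
  · rw [Matrix.one_apply_ne hxy, mul_zero, mul_zero]

open Classical in
theorem sumZZ_edgeFinset_eq (G : SimpleGraph V) (S : Finset V) :
    sumZZ G.edgeFinset = sumZZ {e ∈ G.edgeFinset | Finset.card {u ∈ S | u ∈ e} = 1} +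
      (sumZZ {e ∈ G.edgeFinset | ∀ u ∈ e, u ∈ S} +
        sumZZ {e ∈ G.edgeFinset | ∀ u ∈ e, u ∉ S}) := by
  simp only [sumZZ, Finset.sum_filter, ← Finset.sum_add_distrib]
  refine Finset.sum_congr rfl fun e he => ?_
  rw [SimpleGraph.mem_edgeFinset] at he
  induction e with
  | _ a b =>
  have hab : a ≠ b := G.ne_of_adj he
  have hcard : Finset.filter (fun u => u ∈ s(a, b)) S =
      (if a ∈ S then {a} else ∅) ∪ (if b ∈ S then {b} else ∅) := by
    ext u
    split_ifs <;> simp <;> grind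
  rw [hcard]
  by_cases ha : a ∈ S <;> by_cases hb : b ∈ S <;> simp [ha, hb, hab]

/-- This exhibits `iZ_uZ_v` as a bracket, hence as an element of the derived algebra once `iX_u` and
`iZ_uZ_v` both lie in the algebra. -/
theorem lie_lie_opX_opZZ {u : V} {e : Sym2 V} (h : u ∈ e) :
    ⁅Complex.I • opX u, ⁅Complex.I • opX u, Complex.I • opZZ e⁆⁆ =
      (-4 : ℝ) • (Complex.I • opZZ e) := by
  have h1 := lie_lie_sumX_opZZ {u} e
  have h2 : sumX {u} = opX u := Finset.sum_singleton _ _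
  rw [Finset.filter_singleton, if_pos h, h2, sq, opX_mul_self, mul_one] at h1
  rw [smul_lie, smul_lie, lie_smul, lie_smul, lie_smul, h1, smul_smul, Complex.I_mul_I,
    neg_one_smul, neg_smul, smul_comm (4 : ℝ), Algebra.smul_def (4 : ℝ), map_ofNat]

/-- If `S` is a cell and the induced subgraph on `S` has a free DLA, then the DLA of `G` contains
that of the induced subgraph. -/
theorem standardDLA_inducedOn_le_comap {G : SimpleGraph V} {S : Finset V} (hS : IsMixerCell G S)
    (hfree : HasFreeDLA (inducedOn G S)) :
    standardDLA (inducedOn G S) ≤ (standardDLA G).comap (extendOp S) := by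
  classical
  set H := inducedOn G S
  let I : Submodule ℝ (QubitOp {u // u ∈ S}) := ((standardDLA G).comap (extendOp S)).toSubmodule
  have hI : ∀ M, M ∈ I ↔ extendOp S M ∈ standardDLA G := fun M => Iff.rfl
  have hX : Complex.I • mixerH {u // u ∈ S} ∈ I := by
    rw [hI, extendOp_smul, extendOp_mixerH]
    exact hS
  -- Removing the cut edges of `S` leaves the edges inside `S` plus those inside `Sᶜ`. The latter
  -- commute with every operator on `S`, so this element acts there as the problem Hamiltonian of
  -- `H`, although that Hamiltonian is not yet known to lie in the DLA of `G`.
  have hC : Complex.I • sumZZ {e ∈ G.edgeFinset | ∀ u ∈ e, u ∈ S} +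
      Complex.I • sumZZ {e ∈ G.edgeFinset | ∀ u ∈ e, u ∉ S} ∈ standardDLA G := by
    have h1 := sub_mem (smul_sumZZ_edgeFinset_mem G)
      (sumZZ_filter_cut_mem (smul_sumZZ_edgeFinset_mem G) hS)
    rwa [← smul_sub, sumZZ_edgeFinset_eq G S, add_sub_cancel_left, smul_add] at h1
  have hXI : ∀ M ∈ I, ⁅Complex.I • mixerH {u // u ∈ S}, M⁆ ∈ I := fun M hM =>
    ((standardDLA G).comap (extendOp S)).lie_mem hX hM
  have hZI : ∀ M ∈ I, ⁅Complex.I • problemH H, M⁆ ∈ I := by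
    intro M hM
    rw [hI, LieHom.map_lie, extendOp_smul, extendOp_problemH]
    have h1 := (standardDLA G).lie_mem hC hM
    have h2 : ⁅sumZZ {e ∈ G.edgeFinset | ∀ u ∈ e, u ∉ S}, extendOp S M⁆ = 0 := by
      rw [sumZZ, LieRing.of_associative_ring_bracket, Finset.sum_mul, Finset.mul_sum,
        ← Finset.sum_sub_distrib]
      refine Finset.sum_eq_zero fun e he => ?_
      exact lie_opZZ_extendOp (Finset.mem_filter.1 he).2 M
    have h3 : ⁅Complex.I • sumZZ {e ∈ G.edgeFinset | ∀ u ∈ e, u ∉ S}, extendOp S M⁆ = 0 := by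
      rw [smul_lie, h2, smul_zero]
    change ⁅_, extendOp S M⁆ ∈ _ at h1
    rwa [add_lie, h3, add_zero] at h1
  have hlie : ∀ M ∈ standardDLA H, ∀ N ∈ standardDLA H, ⁅M, N⁆ ∈ I := by
    intro M hM N hN
    rw [standardDLA, Set.pair_comm] at hM hN
    exact lie_mem_of_mem_lieSpan_pair hX hXI hZI hM hN
  have hma : multiAngleDLA H ≤ standardDLA H := hfree.ge
  rw [standardDLA, LieSubalgebra.lieSpan_le]
  rintro M (rfl | rfl)
  · rw [problemH, Finset.smul_sum]
    refine sum_mem fun e he => ?_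
    have hXs : ∀ u, Complex.I • opX u ∈ standardDLA H := fun u =>
      hma (LieSubalgebra.subset_lieSpan (Or.inl ⟨u, rfl⟩))
    have hZs : Complex.I • opZZ e ∈ standardDLA H :=
      hma (LieSubalgebra.subset_lieSpan (Or.inr ⟨e, SimpleGraph.mem_edgeFinset.1 he, rfl⟩))
    have hu : e.out.1 ∈ e := e.out_fst_mem
    have h1 := hlie _ (hXs e.out.1) _ ((standardDLA H).lie_mem (hXs e.out.1) hZs)
    rw [lie_lie_opX_opZZ hu] at h1
    have h2 := I.smul_mem (-(1 / 4) : ℝ) h1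
    rw [smul_smul] at h2
    norm_num at h2
    exact h2
  · exact hX

theorem hasFreeDLA_of_inducedOn {G : SimpleGraph V} {S : Finset V} (hS : IsMixerCell G S)
    (hfree : HasFreeDLA (inducedOn G S)) (hsep : SeparatedBy G Sᶜ S) : HasFreeDLA G := by
  refine hasFreeDLA_of_isMixerCell_singleton
    (isMixerCell_singleton_of_separatedBy (fun u hu => ?_) hS.compl hsep)
  have h1 : Complex.I • opX (⟨u, hu⟩ : {u // u ∈ S}) ∈ standardDLA (inducedOn G S) :=
    hfree.ge (LieSubalgebra.subset_lieSpan (Or.inl ⟨_, rfl⟩))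
  have h2 := standardDLA_inducedOn_le_comap hS hfree h1
  rw [LieSubalgebra.mem_comap, extendOp_smul, extendOp_opX] at h2
  simpa [IsMixerCell, sumX] using h2

theorem hasFreeDLA_of_oddVerts {G : SimpleGraph V}
    (hfree : HasFreeDLA (inducedOn G (oddVerts G)))
    (hsep : SeparatedBy G (evenVerts G) (oddVerts G)) : HasFreeDLA G :=
  hasFreeDLA_of_inducedOn (isMixerCell_oddVerts G) hfree (evenVerts_eq_compl G ▸ hsep)

theorem hasFreeDLA_of_evenVerts {G : SimpleGraph V}
    (hfree : HasFreeDLA (inducedOn G (evenVerts G)))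
    (hsep : SeparatedBy G (oddVerts G) (evenVerts G)) : HasFreeDLA G := by
  refine hasFreeDLA_of_inducedOn (isMixerCell_evenVerts G) hfree ?_
  rwa [evenVerts_eq_compl, compl_compl, ← evenVerts_eq_compl]

end Induced

/-! ### Soundness of the algorithm. -/

theorem hasFreeDLA_of_checkFreeDLA (N : ℕ) {V : Type*} [Fintype V] [DecidableEq V]
    (G : SimpleGraph V) (h : checkFreeDLA N G = true) : HasFreeDLA G := by
  induction hn : Fintype.card V using Nat.strong_induction_on generalizing V with
  | _ n ih =>
  have hcard := card_oddVerts_add_card_evenVerts G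
  unfold checkFreeDLA at h
  split_ifs at h with h1 h2 h3 h4
  · simpa using h
  · exact hasFreeDLA_of_oddVerts (ih _ (by omega) _ h3 (Fintype.card_coe _)) (by simpa using h)
  · exact hasFreeDLA_of_evenVerts (ih _ (by omega) _ h4 (Fintype.card_coe _)) (by simpa using h)

/-! ### A free graph of every order at least seven. -/

section Spider

/-- Adjacency in the spider on `0, …, n - 1` consisting of the path `0, …, n - 2` and a leaf
`n - 1` attached to the vertex `2`. -/
def spiderAdj (n i j : ℕ) : Prop :=
  (i + 1 = j ∧ j + 2 ≤ n) ∨ (j + 1 = i ∧ i + 2 ≤ n) ∨ (i = 2 ∧ j + 1 = n) ∨ (j = 2 ∧ i + 1 = n)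

instance (n i j : ℕ) : Decidable (spiderAdj n i j) := by unfold spiderAdj; infer_instance

/-- The spider, transported to a vertex type along a labelling. -/
def spider {V : Type*} (n : ℕ) (hn : 4 ≤ n) (f : V → ℕ) : SimpleGraph V where
  Adj u v := spiderAdj n (f u) (f v)
  symm := ⟨fun u v h => by unfold spiderAdj at *; omega⟩
  loopless := ⟨fun u h => by unfold spiderAdj at h; omega⟩

theorem card_filter_labelling {V : Type*} [Fintype V] {n : ℕ} (f : V ≃ Fin n) (p : ℕ → Prop)
    [DecidablePred p] [DecidablePred fun v => p (f v)] :
    Finset.card {v : V | p (f v)} = Finset.card {j ∈ Finset.range n | p j} := by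
  refine Finset.card_bij (fun v _ => (f v : ℕ)) ?_ ?_ ?_
  · intro v hv; simpa using hv
  · intro v _ w _ h; exact f.injective (Fin.ext h)
  · intro j hj
    simp only [Finset.mem_filter, Finset.mem_range] at hj
    exact ⟨f.symm ⟨j, hj.1⟩, by simpa using hj.2, by simp⟩

theorem IsMixerCell.neighbors {V : Type*} [Fintype V] [DecidableEq V] {G : SimpleGraph V} {u : V}
    (hu : IsMixerCell G {u}) [DecidablePred (G.Adj u)] :
    IsMixerCell G {v | G.Adj u v} := by
  classical
  refine (congrArg (IsMixerCell G) ?_).mp (hu.compl.filter_adj hu (by simp))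
  ext v
  simp only [Finset.mem_filter, Finset.mem_compl, Finset.mem_singleton, Finset.mem_univ, true_and]
  exact ⟨fun h => h.2, fun h => ⟨fun hv => G.loopless.irrefl u (hv ▸ h), h⟩⟩

theorem IsMixerCell.congr {V : Type*} [Fintype V] [DecidableEq V] {G : SimpleGraph V}
    {A B : Finset V} (hA : IsMixerCell G A) (h : ∀ u, u ∈ B ↔ u ∈ A) : IsMixerCell G B :=
  (Finset.ext h : B = A) ▸ hA

/-- Parity refinement isolates the vertex `3`; taking neighbours and subtracting known cells then
propagates along the legs. The condition `7 ≤ n` keeps `3` and `n - 3` distinct, so each has a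
single odd-degree neighbour. -/
theorem hasFreeDLA_spider {V : Type*} [Fintype V] [DecidableEq V] {n : ℕ} (hn : 7 ≤ n)
    (f : V ≃ Fin n) : HasFreeDLA (spider n (by omega) fun v => (f v : ℕ)) := by
  classical
  set G := spider n (by omega) fun v => (f v : ℕ) with hG
  have hadj : ∀ u v, G.Adj u v ↔ spiderAdj n (f u) (f v) := fun u v => Iff.rfl
  have hlt : ∀ v, (f v : ℕ) < n := fun v => (f v).2
  -- Cells are described by the labels of their elements.
  have hodd : ∀ (i : ℕ) (s : ℕ → Prop) (t : Finset ℕ),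
      (∀ j, (j < n ∧ s j ∧ spiderAdj n i j) ↔ j ∈ t) →
      ∀ u, (f u : ℕ) = i → ∀ B : Finset V, (∀ v, v ∈ B ↔ s (f v)) →
      Finset.card {v ∈ B | G.Adj u v} = t.card := by
    intro i s t ht u hu B hB
    have h1 : Finset.filter (fun v => G.Adj u v) B =
        Finset.univ.filter fun v : V => ( s (f v) ∧ spiderAdj n i (f v)) := by
      ext v; simp [hB, hadj, hu]
    rw [h1, card_filter_labelling f fun j => s j ∧ spiderAdj n i j]
    congr 1
    ext j
    rw [Finset.mem_filter, Finset.mem_range, ht]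
  have hVo : IsMixerCell G {v | (f v : ℕ) = 0 ∨ (f v : ℕ) = 2 ∨ (f v : ℕ) + 2 = n ∨
      (f v : ℕ) + 1 = n} := by
    refine (isMixerCell_oddVerts G).congr fun u => ?_
    have hd : G.degree u = Finset.card {v ∈ Finset.univ | G.Adj u v} := by
      rw [← G.card_neighborFinset_eq_degree, G.neighborFinset_eq_filter]
    have ht := fun t ht => hodd (f u) (fun _ => True) t ht u rfl Finset.univ (by simp)
    have hu := hlt u
    simp only [oddVerts, Finset.mem_filter, Finset.mem_univ, true_and]
    rw [hd]
    obtain h | h | h | h | h | h : (f u : ℕ) = 0 ∨ (f u : ℕ) = 1 ∨ (f u : ℕ) = 2 ∨ (3 ≤ (f u : ℕ) ∧ (f u : ℕ) + 3 ≤ n) ∨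
        (f u : ℕ) + 2 = n ∨ (f u : ℕ) + 1 = n := by omega
    · refine iff_of_true (by omega) ?_
      rw [ht {1} (fun j => by simp [spiderAdj]; omega), Finset.card_singleton]
      decide
    · refine iff_of_false (by omega) ?_
      rw [ht {0, 2} (fun j => by simp [spiderAdj]; omega), Finset.card_pair (by omega)]
      decide
    · refine iff_of_true (by omega) ?_
      rw [ht {1, 3, n - 1} (fun j => by simp [spiderAdj]; omega), Finset.card_eq_three.2 ⟨_, _, _, by omega, by omega, by omega, rfl⟩]
      decide
    · refine iff_of_false (by omega) ?_
      rw [ht {(f u : ℕ) - 1, (f u : ℕ) + 1} (fun j => by simp [spiderAdj]; omega), Finset.card_pair (by omega)]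
      decide
    · refine iff_of_true (by omega) ?_
      rw [ht {n - 3} (fun j => by simp [spiderAdj]; omega), Finset.card_singleton]
      decide
    · refine iff_of_true (by omega) ?_
      rw [ht {2} (fun j => by simp [spiderAdj]; omega), Finset.card_singleton]
      decide
  have hVe : IsMixerCell G {v | (f v : ℕ) ≠ 0 ∧ (f v : ℕ) ≠ 2 ∧ (f v : ℕ) + 2 ≠ n ∧
      (f v : ℕ) + 1 ≠ n} := hVo.compl.congr fun u => by simp
  have hdisj : Disjoint (α := Finset V) {v | (f v : ℕ) = 0 ∨ (f v : ℕ) = 2 ∨ (f v : ℕ) + 2 = n ∨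
      (f v : ℕ) + 1 = n} {v | (f v : ℕ) ≠ 0 ∧ (f v : ℕ) ≠ 2 ∧ (f v : ℕ) + 2 ≠ n ∧
      (f v : ℕ) + 1 ≠ n} := by
    rw [Finset.disjoint_left]; intro v; simp; omega
  have hB : IsMixerCell G {v | (f v : ℕ) = 0 ∨ (f v : ℕ) + 2 = n} := by
    refine (hVo.filter_odd hVe hdisj).congr fun u => ?_
    have ht := fun t ht => hodd (f u) (fun i => i ≠ 0 ∧ i ≠ 2 ∧ i + 2 ≠ n ∧ i + 1 ≠ n) t ht u rfl _
      (fun v => Finset.mem_filter_univ v)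
    have hu := hlt u
    rw [Finset.mem_filter_univ, Finset.mem_filter, Finset.mem_filter_univ]
    by_cases hA : (f u : ℕ) = 0 ∨ (f u : ℕ) = 2 ∨ (f u : ℕ) + 2 = n ∨ (f u : ℕ) + 1 = n
    swap
    · exact iff_of_false (by omega) (fun h => hA h.1)
    rw [and_iff_right hA]
    obtain h | h | h | h : (f u : ℕ) = 0 ∨ (f u : ℕ) = 2 ∨ (f u : ℕ) + 2 = n ∨ (f u : ℕ) + 1 = n := by omega
    · refine iff_of_true (by omega) ?_
      rw [ht {1} (fun j => by simp [spiderAdj]; omega), Finset.card_singleton]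
      decide
    · refine iff_of_false (by omega) ?_
      rw [ht {1, 3} (fun j => by simp [spiderAdj]; omega), Finset.card_pair (by omega)]
      decide
    · refine iff_of_true (by omega) ?_
      rw [ht {n - 3} (fun j => by simp [spiderAdj]; omega), Finset.card_singleton]
      decide
    · refine iff_of_false (by omega) ?_
      rw [ht ∅ (fun j => by simp [spiderAdj]; omega), Finset.card_empty]
      decide
  have hC : IsMixerCell G {v | (f v : ℕ) = 3 ∨ (f v : ℕ) + 3 = n} := by
    refine (hVe.filter_odd hVo hdisj.symm).congr fun u => ?_
    have ht := fun t ht => hodd (f u) (fun i => i = 0 ∨ i = 2 ∨ i + 2 = n ∨ i + 1 = n) t ht u rfl _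
      (fun v => Finset.mem_filter_univ v)
    have hu := hlt u
    rw [Finset.mem_filter_univ, Finset.mem_filter, Finset.mem_filter_univ]
    by_cases hA : (f u : ℕ) ≠ 0 ∧ (f u : ℕ) ≠ 2 ∧ (f u : ℕ) + 2 ≠ n ∧ (f u : ℕ) + 1 ≠ n
    swap
    · exact iff_of_false (by omega) (fun h => hA h.1)
    rw [and_iff_right hA]
    obtain h | h | h | h : (f u : ℕ) = 1 ∨ (f u : ℕ) = 3 ∨ (4 ≤ (f u : ℕ) ∧ (f u : ℕ) + 4 ≤ n) ∨ (f u : ℕ) + 3 = n := by omega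
    · refine iff_of_false (by omega) ?_
      rw [ht {0, 2} (fun j => by simp [spiderAdj]; omega), Finset.card_pair (by omega)]
      decide
    · refine iff_of_true (by omega) ?_
      rw [ht {2} (fun j => by simp [spiderAdj]; omega), Finset.card_singleton]
      decide
    · refine iff_of_false (by omega) ?_
      rw [ht ∅ (fun j => by simp [spiderAdj]; omega), Finset.card_empty]
      decide
    · refine iff_of_true (by omega) ?_
      rw [ht {n - 2} (fun j => by simp [spiderAdj]; omega), Finset.card_singleton]
      decide
  have hA : IsMixerCell G {v | (f v : ℕ) = 2 ∨ (f v : ℕ) + 1 = n} :=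
    (hVo.sdiff hB (fun v => by simp; omega)).congr fun u => by simp; omega
  -- Of `3` and `n - 3`, only `3` is adjacent to a vertex of `{2, n - 1}`: this asymmetry comes from
  -- where the extra leaf is attached.
  have hthree : IsMixerCell G {v | (f v : ℕ) = 3} := by
    refine (hC.filter_odd hA (by rw [Finset.disjoint_left]; intro v; simp; omega)).congr fun u => ?_
    have ht := fun t ht => hodd (f u) (fun i => i = 2 ∨ i + 1 = n) t ht u rfl _
      (fun v => Finset.mem_filter_univ v)
    have hu := hlt u
    rw [Finset.mem_filter_univ, Finset.mem_filter, Finset.mem_filter_univ]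
    by_cases hA : (f u : ℕ) = 3 ∨ (f u : ℕ) + 3 = n
    swap
    · exact iff_of_false (by omega) (fun h => hA h.1)
    rw [and_iff_right hA]
    obtain h | h : (f u : ℕ) = 3 ∨ (f u : ℕ) + 3 = n := by omega
    · refine iff_of_true (by omega) ?_
      rw [ht {2} (fun j => by simp [spiderAdj]; omega), Finset.card_singleton]
      decide
    · refine iff_of_false (by omega) ?_
      rw [ht ∅ (fun j => by simp [spiderAdj]; omega), Finset.card_empty]
      decide
  have hsing : ∀ u, IsMixerCell G {v | (f v : ℕ) = (f u : ℕ)} ↔ IsMixerCell G {u} := by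
    intro u
    refine iff_of_eq (congrArg (IsMixerCell G) ?_)
    ext v
    simp only [Finset.mem_filter_univ, Finset.mem_singleton]
    exact ⟨fun h => f.injective (Fin.ext h), fun h => h ▸ rfl⟩
  have hnb : ∀ i < n, IsMixerCell G {v | (f v : ℕ) = i} →
      IsMixerCell G {v | spiderAdj n i (f v)} := by
    intro i hi h
    have h1 := (hsing (f.symm ⟨i, hi⟩)).1 (by simpa using h)
    exact h1.neighbors.congr fun v => by simp [hadj]
  have hfour : IsMixerCell G {v | (f v : ℕ) = 4} := by
    have h3 : IsMixerCell G {f.symm ⟨3, by omega⟩} := (hsing _).1 (by simpa using hthree)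
    refine ((hVe.sdiff hthree fun v => by simp; omega).filter_adj h3 (by simp)).congr fun u => ?_
    simp [hadj, spiderAdj]
    omega
  have hpath : ∀ i, i + 5 ≤ n → IsMixerCell G {v | (f v : ℕ) = i + 3} := by
    intro i
    induction i using Nat.strong_induction_on with
    | _ i ih =>
    intro hi
    match i with
    | 0 => exact hthree
    | 1 => exact hfour
    | i + 2 =>
      refine ((hnb (i + 4) (by omega) (ih (i + 1) (by omega) (by omega))).sdiff
        (ih i (by omega) (by omega)) fun v => ?_).congr fun v => ?_
      · simp [spiderAdj]; omega
      · simp [spiderAdj]; omega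
  have htwo : IsMixerCell G {v | (f v : ℕ) = 2} :=
    ((hnb 3 (by omega) hthree).sdiff hfour fun v => by simp [spiderAdj]; omega).congr fun v => by
      simp [spiderAdj]; omega
  have hlast : IsMixerCell G {v | (f v : ℕ) = n - 1} :=
    (hA.sdiff htwo fun v => by simp; omega).congr fun v => by simp; omega
  have hone : IsMixerCell G {v | (f v : ℕ) = 1} :=
    (((hnb 2 (by omega) htwo).sdiff hthree fun v => by simp [spiderAdj]; omega).sdiff hlast
      fun v => by simp [spiderAdj]; omega).congr fun v => by simp [spiderAdj]; omega
  have hzero : IsMixerCell G {v | (f v : ℕ) = 0} :=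
    ((hnb 1 (by omega) hone).sdiff htwo fun v => by simp [spiderAdj]; omega).congr fun v => by
      simp [spiderAdj]; omega
  refine hasFreeDLA_of_isMixerCell_singleton fun u => (hsing u).1 ?_
  have hu := hlt u
  by_cases h3 : 3 ≤ (f u : ℕ) ∧ (f u : ℕ) + 2 ≤ n
  · have := hpath (f u - 3) (by omega)
    rwa [Nat.sub_add_cancel h3.1] at this
  · have : (f u : ℕ) = 0 ∨ (f u : ℕ) = 1 ∨ (f u : ℕ) = 2 ∨ (f u : ℕ) = n - 1 := by omega
    rcases this with h | h | h | h <;> rw [h] <;> assumption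

end Spider

/-! ### Counting graphs with prescribed degree parities. -/

section Counting

variable {V : Type*} [Fintype V] [DecidableEq V]

omit [DecidableEq V] in
open Classical in
theorem mem_oddVerts {G : SimpleGraph V} {u : V} :
    u ∈ oddVerts G ↔ Odd (Finset.card {v | G.Adj u v}) := by
  rw [oddVerts, Finset.mem_filter_univ, ← G.card_neighborFinset_eq_degree,
    G.neighborFinset_eq_filter]

theorem adj_iff_of_mem_oddVerts_iff {G G' : SimpleGraph V} {u w : V}
    (hu : u ∈ oddVerts G ↔ u ∈ oddVerts G') (h : ∀ v, v ≠ w → (G.Adj u v ↔ G'.Adj u v)) :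
    G.Adj u w ↔ G'.Adj u w := by
  classical
  have hsplit : ∀ G : SimpleGraph V, Finset.card {v | G.Adj u v} =
      Finset.card {v ∈ Finset.univ.erase w | G.Adj u v} + if G.Adj u w then 1 else 0 := by
    intro G
    rw [← Finset.insert_erase (Finset.mem_univ w), Finset.filter_insert]
    split_ifs with hw
    · rw [Finset.card_insert_of_notMem (by simp)]; simp
    · simp
  have heq : Finset.card {v ∈ Finset.univ.erase w | G.Adj u v} =
      Finset.card {v ∈ Finset.univ.erase w | G'.Adj u v} := by
    congr 1
    exact Finset.filter_congr fun v hv => h v (Finset.ne_of_mem_erase hv)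
  rw [mem_oddVerts, mem_oddVerts, hsplit, hsplit, heq] at hu
  by_cases h1 : G.Adj u w <;> by_cases h2 : G'.Adj u w <;>
    simp only [h1, h2, if_true, if_false, Nat.odd_add_one, add_zero] at hu ⊢ <;> tauto

instance SimpleGraph.instMeasurableSingletonClass {V : Type*} [Finite V] :
    MeasurableSingletonClass (SimpleGraph V) where
  measurableSet_singleton G := by
    rw [← SimpleGraph.edgeSet_injective.preimage_image {G}, Set.image_singleton]
    exact SimpleGraph.measurable_edgeSet (measurableSet_singleton _)

omit [DecidableEq V] in
open SimpleGraph in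
theorem binomialRandom_half_singleton (G : SimpleGraph V) :
    binomialRandom V ⟨1 / 2, by norm_num, by norm_num⟩ {G} =
      ENNReal.ofReal ((1 / 2) ^ (Fintype.card V).choose 2) := by
  classical
  have hle : G.edgeSet.ncard ≤ (Fintype.card V).choose 2 := by
    rw [← SimpleGraph.coe_edgeFinset, Set.ncard_coe_finset]
    exact G.card_edgeFinset_le_card_choose_two
  have h1 : (unitInterval.toNNReal ⟨1 / 2, by norm_num, by norm_num⟩ : ENNReal) =
      ENNReal.ofReal (1 / 2) := by
    rw [ENNReal.ofReal]
    congr 1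
    ext
    simp
  have h2 : unitInterval.symm ⟨1 / 2, by norm_num, by norm_num⟩ = ⟨1 / 2, by norm_num, by norm_num⟩ := by
    ext
    norm_num [unitInterval.symm]
  rw [binomialRandom_singleton, Nat.card_eq_fintype_card, h2, h1, ← pow_add,
    Nat.add_sub_cancel' hle, ENNReal.ofReal_pow (by norm_num)]

-- At edge probability `1/2` all graphs have equal weight, so probabilities are normalized
-- cardinalities.
omit [DecidableEq V] in
open SimpleGraph in
theorem binomialRandom_half_real (A : Finset (SimpleGraph V)) :
    (binomialRandom V ⟨1 / 2, by norm_num, by norm_num⟩).real A =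
      A.card * (1 / 2) ^ (Fintype.card V).choose 2 := by
  rw [← sum_measureReal_singleton, Finset.sum_congr rfl fun G _ => by
    rw [Measure.real, binomialRandom_half_singleton G, ENNReal.toReal_ofReal (by positivity)],
    Finset.sum_const, nsmul_eq_mul]

theorem card_simpleGraph : Fintype.card (SimpleGraph V) = 2 ^ (Fintype.card V).choose 2 := by
  have h := binomialRandom_half_real (Finset.univ : Finset (SimpleGraph V))
  rw [Finset.coe_univ, probReal_univ, Finset.card_univ, one_div, inv_pow] at h
  have h2 : (Fintype.card (SimpleGraph V) : ℝ) = 2 ^ (Fintype.card V).choose 2 := by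
    field_simp at h
    exact h.symm
  exact_mod_cast h2

-- The edges avoiding `w` determine the rest: the degree parity at each `u ≠ w` fixes whether `uw`
-- is an edge.
open Classical in
theorem card_oddVerts_eq_le (S : Finset V) (w : V) :
    Finset.card {G : SimpleGraph V | oddVerts G = S} ≤ 2 ^ (Fintype.card V - 1).choose 2 := by
  have h1 : Fintype.card (SimpleGraph {v // v ≠ w}) = 2 ^ (Fintype.card V - 1).choose 2 := by
    rw [card_simpleGraph, Fintype.card_subtype_compl, Fintype.card_subtype_eq]
  rw [← h1, ← Finset.card_univ]
  refine Finset.card_le_card_of_injOn (fun G => G.comap Subtype.val) (by simp) ?_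
  intro G hG G' hG' h
  simp only [Finset.coe_filter, Finset.mem_univ, true_and, Set.mem_ofPred_eq] at hG hG'
  have hoff : ∀ u v, u ≠ w → v ≠ w → (G.Adj u v ↔ G'.Adj u v) := by
    intro u v hu hv
    have := congrArg (fun H => H.Adj ⟨u, hu⟩ ⟨v, hv⟩) h
    simpa using this
  have hw : ∀ u, u ≠ w → (G.Adj u w ↔ G'.Adj u w) := fun u hu =>
    adj_iff_of_mem_oddVerts_iff (by rw [hG, hG']) fun v hv => hoff u v hu hv
  ext u v
  by_cases hu : u = w
  · by_cases hv : v = w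
    · subst hu hv; simp
    · rw [hu, G.adj_comm, G'.adj_comm, hw v hv]
  · by_cases hv : v = w
    · rw [hv, hw u hu]
    · exact hoff u v hu hv

-- Given both induced subgraphs and the parities, the cross edges are determined by those avoiding
-- `s` and `w`. Together with `choose_two_add_choose_two`, this makes the two sides behave like
-- independent uniform graphs.
open Classical in
theorem card_oddVerts_eq_and_inducedOn_le (S : Finset V) {s w : V} (hs : s ∈ S) (hw : w ∈ Sᶜ)
    (P : SimpleGraph {u // u ∈ S} → Prop) (Q : SimpleGraph {u // u ∈ Sᶜ} → Prop) :
    Finset.card {G : SimpleGraph V | oddVerts G = S ∧ P (inducedOn G S) ∧ Q (inducedOn G Sᶜ)} ≤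
      Finset.card {H | P H} * (Finset.card {H | Q H} * 2 ^ ((S.card - 1) * (Sᶜ.card - 1))) := by
  have h1 : 2 ^ ((S.card - 1) * (Sᶜ.card - 1)) =
      (S.erase s ×ˢ Sᶜ.erase w).powerset.card := by
    rw [Finset.card_powerset, Finset.card_product, Finset.card_erase_of_mem hs,
      Finset.card_erase_of_mem hw]
  rw [h1, ← Finset.card_product, ← Finset.card_product]
  refine Finset.card_le_card_of_injOn (fun G => (inducedOn G S, inducedOn G Sᶜ,
    {p ∈ S.erase s ×ˢ Sᶜ.erase w | G.Adj p.1 p.2})) ?_ ?_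
  · intro G hG
    simp only [Finset.coe_filter, Finset.mem_univ, true_and, Set.mem_ofPred_eq] at hG
    simp only [Finset.coe_product, Set.mem_prod, Finset.mem_coe, Finset.mem_filter_univ, hG.2.1,
      hG.2.2, Finset.mem_powerset, Finset.filter_subset, and_self]
  intro G hG G' hG' h
  simp only [Finset.coe_filter, Finset.mem_univ, true_and, Set.mem_ofPred_eq] at hG hG'
  obtain ⟨h1, h2, h3⟩ : inducedOn G S = inducedOn G' S ∧ inducedOn G Sᶜ = inducedOn G' Sᶜ ∧
      Finset.filter (fun p : V × V => G.Adj p.1 p.2) (S.erase s ×ˢ Sᶜ.erase w) =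
      Finset.filter (fun p : V × V => G'.Adj p.1 p.2) (S.erase s ×ˢ Sᶜ.erase w) := by
    simpa [Prod.ext_iff] using h
  have hSS : ∀ u ∈ S, ∀ v ∈ S, (G.Adj u v ↔ G'.Adj u v) := fun u hu v hv => by
    have := congrArg (fun H => H.Adj ⟨u, hu⟩ ⟨v, hv⟩) h1
    simpa [inducedOn] using this
  have hTT : ∀ u ∈ Sᶜ, ∀ v ∈ Sᶜ, (G.Adj u v ↔ G'.Adj u v) := fun u hu v hv => by
    have := congrArg (fun H => H.Adj ⟨u, hu⟩ ⟨v, hv⟩) h2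
    simpa [inducedOn] using this
  have hST : ∀ u ∈ S, ∀ v ∈ Sᶜ, u ≠ s → v ≠ w → (G.Adj u v ↔ G'.Adj u v) := by
    intro u hu v hv hus hvw
    have := congrArg (fun F => (u, v) ∈ F) h3
    rw [Finset.mem_compl] at hv
    simpa [hu, hv, hus, hvw] using this
  -- The parity at `v` recovers the edges to `s`; only afterwards does the parity at each `u ∈ S`
  -- recover the edges to `w`, including `sw`.
  have hs' : ∀ v ∈ Sᶜ, v ≠ w → (G.Adj v s ↔ G'.Adj v s) := fun v hv hvw =>
    adj_iff_of_mem_oddVerts_iff (by rw [hG.1, hG'.1]) fun u hus => by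
      by_cases hu : u ∈ S
      · rw [G.adj_comm, G'.adj_comm, hST u hu v hv hus hvw]
      · exact hTT v hv u (Finset.mem_compl.2 hu)
  have hST' : ∀ u ∈ S, ∀ v ∈ Sᶜ, v ≠ w → (G.Adj u v ↔ G'.Adj u v) := by
    intro u hu v hv hvw
    by_cases hus : u = s
    · rw [hus, G.adj_comm, G'.adj_comm, hs' v hv hvw]
    · exact hST u hu v hv hus hvw
  have hcross : ∀ u ∈ S, ∀ v ∈ Sᶜ, (G.Adj u v ↔ G'.Adj u v) := by
    intro u hu v hv
    by_cases hvw : v = w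
    · rw [hvw]
      refine adj_iff_of_mem_oddVerts_iff (by rw [hG.1, hG'.1]) fun x hx => ?_
      by_cases hxS : x ∈ S
      · exact hSS u hu x hxS
      · exact hST' u hu x (Finset.mem_compl.2 hxS) hx
    · exact hST' u hu v hv hvw
  ext u v
  by_cases hu : u ∈ S <;> by_cases hv : v ∈ S
  · exact hSS u hu v hv
  · exact hcross u hu v (Finset.mem_compl.2 hv)
  · rw [G.adj_comm, G'.adj_comm]
    exact hcross v hv u (Finset.mem_compl.2 hu)
  · exact hTT u (Finset.mem_compl.2 hu) v (Finset.mem_compl.2 hv)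

theorem card_powerset_filter_even {α : Type*} [DecidableEq α] {S : Finset α} (hS : S.Nonempty) :
    2 * Finset.card {T ∈ S.powerset | Even T.card} = 2 ^ S.card := by
  have h1 := Finset.sum_powerset_neg_one_pow_card_of_nonempty hS
  have h2 : ∑ T ∈ S.powerset, (1 : ℤ) = 2 ^ S.card := by simp
  have h3 : ∑ T ∈ S.powerset, (1 + (-1 : ℤ) ^ T.card) =
      2 * (Finset.card {T ∈ S.powerset | Even T.card} : ℤ) := by
    rw [Finset.card_filter, Nat.cast_sum, Finset.mul_sum]
    refine Finset.sum_congr rfl fun T _ => ?_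
    rcases Nat.even_or_odd T.card with h | h
    · simp [h]
    · simp [h.neg_one_pow, Nat.not_even_iff_odd.2 h]
  rw [Finset.sum_add_distrib, h1, h2, add_zero] at h3
  exact_mod_cast h3.symm

/-- The graph joining two vertices `u`, `w` outside `S` to all vertices of a subset `T` of `S`. -/
def joinPair (S T : Finset V) (u w : V) (hT : T ⊆ S) (hu : u ∉ S) (hw : w ∉ S) :
    SimpleGraph V where
  Adj x y := ((x = u ∨ x = w) ∧ y ∈ T) ∨ ((y = u ∨ y = w) ∧ x ∈ T)
  symm := ⟨fun x y h => h.symm⟩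
  loopless := ⟨fun x h => by
    rcases h with ⟨rfl | rfl, h⟩ | ⟨rfl | rfl, h⟩
    exacts [hu (hT h), hw (hT h), hu (hT h), hw (hT h)]⟩

theorem Finset.odd_card_symmDiff_iff {α : Type*} [DecidableEq α] (A B : Finset α)
    (hB : Even B.card) : Odd (symmDiff A B).card ↔ Odd A.card := by
  have h1 : (symmDiff A B).card + 2 * (A ∩ B).card = A.card + B.card := by
    rw [symmDiff_eq_sup_sdiff_inf, Finset.sup_eq_union, Finset.inf_eq_inter,
      Finset.card_sdiff_of_subset (Finset.inter_subset_union)]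
    have := Finset.card_union_add_card_inter A B
    have := Finset.card_le_card (Finset.inter_subset_union (s := A) (t := B))
    omega
  grind

theorem oddVerts_symmDiff_joinPair (G : SimpleGraph V) {S T : Finset V} {u w : V} (hT : T ⊆ S)
    (hu : u ∉ S) (hw : w ∉ S) (huw : u ≠ w) (heven : Even T.card) :
    oddVerts (symmDiff G (joinPair S T u w hT hu hw)) = oddVerts G := by
  classical
  ext x
  rw [mem_oddVerts, mem_oddVerts]
  have h1 : Finset.univ.filter (fun v => (symmDiff G (joinPair S T u w hT hu hw)).Adj x v) =
      symmDiff (Finset.univ.filter fun v => G.Adj x v)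
        (Finset.univ.filter fun v => (joinPair S T u w hT hu hw).Adj x v) := by
    ext v
    simp [symmDiff_def]
  rw [h1]
  refine Finset.odd_card_symmDiff_iff _ _ ?_
  by_cases hx : x = u ∨ x = w
  · have hxT : x ∉ T := fun h => by rcases hx with rfl | rfl; exacts [hu (hT h), hw (hT h)]
    convert heven
    ext v
    simp [joinPair, hx, hxT]
  · by_cases hxT : x ∈ T
    · have : Finset.univ.filter (fun v => (joinPair S T u w hT hu hw).Adj x v) = {u, w} := by
        ext v; simp [joinPair, hx, hxT]
      rw [this, Finset.card_pair huw]
      decide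
    · have : Finset.univ.filter (fun v => (joinPair S T u w hT hu hw).Adj x v) = ∅ := by
        ext v; simp [joinPair, hx, hxT]
      rw [this, Finset.card_empty]
      decide

/-- A family of graphs that is determined by the degree parities and by the adjacency inside `S`
and inside its complement. -/
def CutInvariant (S : Finset V) (F : Finset (SimpleGraph V)) : Prop :=
  ∀ G ∈ F, ∀ G', oddVerts G' = oddVerts G →
    (∀ x y, (x ∈ S ↔ y ∈ S) → (G'.Adj x y ↔ G.Adj x y)) → G' ∈ F

-- Switching: for an even `T ⊆ S`, toggle all edges from `u` and from `w` to `T`. Every degree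
-- changes by an even amount, so the result stays in `F`. If `u` and `v` had equal neighbourhoods in
-- `S`, then `T` is recovered as the set where they now differ, so the map is injective on pairs
-- `(G, T)`. The third vertex `w` serves to repair the parities on `T`.
open Classical in
theorem card_filter_neighborSet_eq_le {S : Finset V} {F : Finset (SimpleGraph V)}
    (hF : CutInvariant S F) {u v w : V} (hu : u ∉ S) (hv : v ∉ S) (hw : w ∉ S) (huv : u ≠ v)
    (huw : u ≠ w) (hvw : v ≠ w) (hS : S.Nonempty) :
    Finset.card {G ∈ F | G.neighborSet u ∩ (S : Set V) = G.neighborSet v ∩ (S : Set V)} * 2 ^ S.card ≤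
      2 * F.card := by
  rw [← card_powerset_filter_even hS, mul_left_comm, ← Finset.card_product]
  refine Nat.mul_le_mul_left 2 ?_
  have hsub : ∀ T ∈ Finset.filter (fun T : Finset V => Even T.card) S.powerset, T ⊆ S := by
    intro T hT; simpa using (Finset.mem_filter.1 hT).1
  let flip : SimpleGraph V × Finset V → SimpleGraph V := fun p =>
    if h : p.2 ⊆ S then symmDiff p.1 (joinPair S p.2 u w h hu hw) else p.1
  have hflip : ∀ G T (h : T ⊆ S), flip (G, T) = symmDiff G (joinPair S T u w h hu hw) :=
    fun G T h => dif_pos h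
  refine Finset.card_le_card_of_injOn flip ?_ ?_
  · rintro ⟨G, T⟩ hGT
    simp only [Finset.coe_product, Set.mem_prod, Finset.mem_coe] at hGT
    obtain ⟨hG, hT⟩ := hGT
    have hTS := hsub T hT
    rw [hflip G T hTS]
    refine hF G (Finset.mem_filter.1 hG).1 _
      (oddVerts_symmDiff_joinPair G hTS hu hw huw (Finset.mem_filter.1 hT).2) ?_
    intro x y hxy
    have : ¬ (joinPair S T u w hTS hu hw).Adj x y := by
      rintro (⟨rfl | rfl, h⟩ | ⟨rfl | rfl, h⟩)
      · exact hu (hxy.2 (hTS h))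
      · exact hw (hxy.2 (hTS h))
      · exact hu (hxy.1 (hTS h))
      · exact hw (hxy.1 (hTS h))
    simp [symmDiff_def, this]
  · rintro ⟨G, T⟩ hGT ⟨G', T'⟩ hGT' h
    simp only [Finset.coe_product, Set.mem_prod, Finset.mem_coe] at hGT hGT'
    have hTS := hsub T hGT.2
    have hTS' := hsub T' hGT'.2
    rw [hflip G T hTS, hflip G' T' hTS'] at h
    have hrow : ∀ (G : SimpleGraph V) (T : Finset V) (hTS : T ⊆ S),
        G.neighborSet u ∩ (S : Set V) = G.neighborSet v ∩ (S : Set V) → ∀ x ∈ S,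
        (x ∈ T ↔ ¬ ((symmDiff G (joinPair S T u w hTS hu hw)).Adj u x ↔
          (symmDiff G (joinPair S T u w hTS hu hw)).Adj v x)) := by
      intro G T hTS hG x hx
      have h1 : G.Adj u x ↔ G.Adj v x := by
        have := congrArg (fun A => x ∈ A) hG
        simpa [hx] using this
      have hvT : v ∉ T := fun h => hv (hTS h)
      have huT : u ∉ T := fun h => hu (hTS h)
      simp only [symmDiff_def, SimpleGraph.sup_adj, SimpleGraph.sdiff_adj, joinPair, h1, hvT, huT,
        huv.symm, hvw, huw]
      tauto
    have hTT : T = T' := by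
      ext x
      by_cases hx : x ∈ S
      · rw [hrow G T hTS (Finset.mem_filter.1 hGT.1).2 x hx,
          hrow G' T' hTS' (Finset.mem_filter.1 hGT'.1).2 x hx, h]
      · exact iff_of_false (fun h => hx (hTS h)) (fun h => hx (hTS' h))
    subst hTT
    rw [symmDiff_left_injective _ h]

open Classical in
theorem card_filter_not_separatedBy_le {S : Finset V} {F : Finset (SimpleGraph V)}
    (hF : CutInvariant S F) (hS : S.Nonempty) (hSc : 3 ≤ Sᶜ.card) :
    Finset.card {G ∈ F | ¬ SeparatedBy G Sᶜ S} * 2 ^ S.card ≤ 2 * Sᶜ.card ^ 2 * F.card := by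
  have hsub : Finset.filter (fun G => ¬ SeparatedBy G Sᶜ S) F ⊆ (Sᶜ.offDiag).biUnion fun p =>
      {G ∈ F | G.neighborSet p.1 ∩ (S : Set V) = G.neighborSet p.2 ∩ (S : Set V)} := by
    intro G hG
    simp only [Finset.mem_filter, SeparatedBy, not_forall] at hG
    obtain ⟨hGF, u, hu, v, hv, huv, h⟩ := hG
    simp only [Finset.mem_biUnion, Finset.mem_offDiag, Finset.mem_filter]
    exact ⟨(u, v), ⟨hu, hv, huv⟩, hGF, not_not.1 h⟩
  calc _ ≤ (∑ p ∈ Sᶜ.offDiag,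
        Finset.card {G ∈ F | G.neighborSet p.1 ∩ (S : Set V) = G.neighborSet p.2 ∩ (S : Set V)}) * 2 ^ S.card :=
        Nat.mul_le_mul_right _ ((Finset.card_le_card hsub).trans Finset.card_biUnion_le)
    _ ≤ ∑ p ∈ Sᶜ.offDiag, 2 * F.card := by
        rw [Finset.sum_mul]
        refine Finset.sum_le_sum fun p hp => ?_
        obtain ⟨h1, h2, h3⟩ := Finset.mem_offDiag.1 hp
        obtain ⟨w, hw, hwne⟩ := Finset.exists_mem_notMem_of_card_lt_card
          (s := {p.1, p.2}) (t := Sᶜ) (by rw [Finset.card_pair h3]; omega)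
        simp only [Finset.mem_insert, Finset.mem_singleton, not_or] at hwne
        exact card_filter_neighborSet_eq_le hF (Finset.mem_compl.1 h1) (Finset.mem_compl.1 h2)
          (Finset.mem_compl.1 hw) h3 (Ne.symm hwne.1) (Ne.symm hwne.2) hS
    _ ≤ _ := by
        rw [Finset.sum_const, smul_eq_mul, Finset.offDiag_card]
        have : Sᶜ.card * Sᶜ.card - Sᶜ.card ≤ Sᶜ.card ^ 2 := by rw [sq]; omega
        nlinarith

end Counting

/-! ### The failure recursion and its exponential solution. -/

section Recursion

variable {V : Type} [Fintype V] [DecidableEq V]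

/-- The graphs on `V` on which the algorithm answers `false`. -/
noncomputable def checkFailures (N : ℕ) (V : Type) [Fintype V] [DecidableEq V] :
    Finset (SimpleGraph V) :=
  open Classical in {G | checkFreeDLA N G = false}

theorem checkFreeDLA_eq_false_cases {N : ℕ} {G : SimpleGraph V} {S : Finset V}
    (hN : N < Fintype.card V) (hG : oddVerts G = S) (hS : 4 ≤ S.card) (hSc : 4 ≤ Sᶜ.card)
    (h : checkFreeDLA N G = false) :
    (checkFreeDLA N (inducedOn G S) = false ∧ checkFreeDLA N (inducedOn G Sᶜ) = false) ∨
      ¬ SeparatedBy G Sᶜ S ∨ ¬ SeparatedBy G S Sᶜ := by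
  subst hG
  unfold checkFreeDLA at h
  rw [evenVerts_eq_compl, if_neg (by omega), dif_neg (by omega)] at h
  split_ifs at h with h1 h2
  · exact Or.inr (Or.inl (by simpa using h))
  · exact Or.inr (Or.inr (by simpa using h))
  · exact Or.inl ⟨by simpa using h1, by simpa using h2⟩

theorem CutInvariant.compl {S : Finset V} {F : Finset (SimpleGraph V)} (h : CutInvariant S F) :
    CutInvariant Sᶜ F := fun G hG G' h1 h2 => h G hG G' h1 fun x y hxy =>
  h2 x y (by rw [Finset.mem_compl, Finset.mem_compl, hxy])

omit [Fintype V] [DecidableEq V] in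
theorem inducedOn_congr {G G' : SimpleGraph V} {S : Finset V}
    (h : ∀ x ∈ S, ∀ y ∈ S, (G'.Adj x y ↔ G.Adj x y)) : inducedOn G' S = inducedOn G S := by
  ext x y
  exact h x x.2 y y.2

/-- A bound, up to a constant factor, for the probability that the vertices on one side of a cut
are not told apart by the other side. -/
noncomputable def cutError (S : Finset V) : ℝ :=
  2 * (Fintype.card V : ℝ) ^ 2 * ((1 / 2) ^ S.card + (1 / 2) ^ Sᶜ.card)

theorem one_le_cutError {S : Finset V} (hV : 7 ≤ Fintype.card V)
    (h : S.card ≤ 6 ∨ Sᶜ.card ≤ 6) : 1 ≤ cutError S := by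
  have hV' : (7 : ℝ) ≤ Fintype.card V := by exact_mod_cast hV
  have h6 : ∀ k ≤ 6, (1 / 64 : ℝ) ≤ (1 / 2) ^ k := fun k hk => by
    calc (1 / 64 : ℝ) = (1 / 2) ^ 6 := by norm_num
      -- With a side of at most six vertices and `n ≥ 7`, the error is at least `2 · 49 / 64 > 1`.
      _ ≤ (1 / 2) ^ k := pow_le_pow_of_le_one (by norm_num) (by norm_num) hk
  have h1 : (1 / 64 : ℝ) ≤ (1 / 2) ^ S.card + (1 / 2) ^ Sᶜ.card := by
    rcases h with h | h
    · exact (h6 _ h).trans (le_add_of_nonneg_right (by positivity))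
    · exact (h6 _ h).trans (le_add_of_nonneg_left (by positivity))
  have h2 : (49 : ℝ) ≤ (Fintype.card V : ℝ) ^ 2 := by nlinarith
  rw [cutError]
  nlinarith

-- Separation failures are counted only among graphs where not both recursive calls fail. That
-- family depends only on the parities and the two induced subgraphs, so the switching bound applies
-- to it. The saving is the factor `1 - p` in `card_checkFailures_filter_le`.
open Classical in
theorem card_checkFailures_filter_le_add {N : ℕ} (hN : N < Fintype.card V) {S : Finset V}
    (hS : 4 ≤ S.card) (hSc : 4 ≤ Sᶜ.card) :
    (Finset.card {G ∈ checkFailures N V | oddVerts G = S} : ℝ) ≤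
      Finset.card {G : SimpleGraph V | oddVerts G = S ∧ checkFreeDLA N (inducedOn G S) = false ∧
        checkFreeDLA N (inducedOn G Sᶜ) = false} + cutError S *
      Finset.card {G : SimpleGraph V | oddVerts G = S ∧ ¬ (checkFreeDLA N (inducedOn G S) = false ∧
        checkFreeDLA N (inducedOn G Sᶜ) = false)} := by
  set Q : Finset (SimpleGraph V) := {G | oddVerts G = S ∧
    ¬ (checkFreeDLA N (inducedOn G S) = false ∧ checkFreeDLA N (inducedOn G Sᶜ) = false)} with hQ
  have hQinv : CutInvariant S Q := by
    intro G hG G' h1 h2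
    have e1 : inducedOn G' S = inducedOn G S :=
      inducedOn_congr fun x hx y hy => h2 x y (iff_of_true hx hy)
    have e2 : inducedOn G' Sᶜ = inducedOn G Sᶜ :=
      inducedOn_congr fun x hx y hy =>
        h2 x y (iff_of_false (Finset.mem_compl.1 hx) (Finset.mem_compl.1 hy))
    rw [hQ, Finset.mem_filter_univ] at hG ⊢
    rwa [h1, e1, e2]
  have hsub : Finset.filter (fun G => oddVerts G = S) (checkFailures N V) ⊆
      (Finset.univ.filter fun G : SimpleGraph V => oddVerts G = S ∧
        checkFreeDLA N (inducedOn G S) = false ∧ checkFreeDLA N (inducedOn G Sᶜ) = false) ∪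
      ((Q.filter fun G => ¬ SeparatedBy G Sᶜ S) ∪ (Q.filter fun G => ¬ SeparatedBy G S Sᶜ)) := by
    intro G hG
    simp only [Finset.mem_filter, checkFailures, Finset.mem_univ, true_and] at hG
    have h1 := checkFreeDLA_eq_false_cases hN hG.2 hS hSc hG.1
    simp only [Finset.mem_union, Finset.mem_filter, hQ, Finset.mem_univ, true_and, hG.2]
    tauto
  have h1 := card_filter_not_separatedBy_le hQinv (Finset.card_pos.1 (by omega)) (by omega)
  have h2 := card_filter_not_separatedBy_le hQinv.compl (Finset.card_pos.1 (by omega))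
    (by rw [compl_compl]; omega)
  rw [compl_compl] at h2
  have h3 := (Finset.card_le_card hsub).trans ((Finset.card_union_le _ _).trans
    (Nat.add_le_add_left (Finset.card_union_le _ _) _))
  have hhalf : ∀ (A a b : ℕ), A * 2 ^ a ≤ 2 * b ^ 2 * Q.card → b ≤ Fintype.card V →
      (A : ℝ) ≤ 2 * (Fintype.card V : ℝ) ^ 2 * (1 / 2) ^ a * Q.card := by
    intro A a b h hb
    have h' : (A : ℝ) * 2 ^ a ≤ 2 * (b : ℝ) ^ 2 * Q.card := by exact_mod_cast h
    have hb' : (b : ℝ) ^ 2 ≤ (Fintype.card V : ℝ) ^ 2 := by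
      have : (b : ℝ) ≤ Fintype.card V := by exact_mod_cast hb
      gcongr
    calc (A : ℝ) = A * 2 ^ a * (1 / 2) ^ a := by
          rw [mul_assoc, ← mul_pow]; norm_num
      _ ≤ 2 * (b : ℝ) ^ 2 * Q.card * (1 / 2) ^ a := by gcongr
      _ ≤ 2 * (Fintype.card V : ℝ) ^ 2 * Q.card * (1 / 2) ^ a := by gcongr
      _ = _ := by ring
  have h4 := hhalf _ _ _ h1 (Finset.card_le_univ _)
  have h5 := hhalf _ _ _ h2 (Finset.card_le_univ _)
  have h6 := (Nat.cast_le (α := ℝ)).2 h3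
  push_cast at h6
  refine h6.trans (add_le_add_right ((add_le_add h4 h5).trans_eq ?_) _)
  rw [cutError]
  ring

theorem choose_two_add_choose_two (a b : ℕ) (ha : 1 ≤ a) (hb : 1 ≤ b) :
    a.choose 2 + (b.choose 2 + (a - 1) * (b - 1)) = (a + b - 1).choose 2 := by
  obtain ⟨a, rfl⟩ := Nat.exists_eq_add_of_le' ha
  obtain ⟨b, rfl⟩ := Nat.exists_eq_add_of_le' hb
  have h : a + 1 + (b + 1) - 1 = a + b + 1 := by omega
  rw [h]
  have : ((a + 1).choose 2 + ((b + 1).choose 2 + (a + 1 - 1) * (b + 1 - 1)) : ℚ) =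
      ((a + b + 1).choose 2 : ℚ) := by
    rw [Nat.cast_choose_two, Nat.cast_choose_two, Nat.cast_choose_two]
    push_cast; ring
  simp only [Nat.add_sub_cancel]
  have h2 : ((a + 1).choose 2 + ((b + 1).choose 2 + a * b) : ℚ) = ((a + b + 1).choose 2 : ℚ) := by
    rw [← this]; ring
  exact_mod_cast h2

open Classical in
theorem card_checkFailures_filter_le {N : ℕ} (hN : N < Fintype.card V) (hV : 7 ≤ Fintype.card V)
    (S : Finset V) {p : ℝ} (hp1 : p ≤ 1)
    (hp : 7 ≤ S.card → 7 ≤ Sᶜ.card →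
      ((checkFailures N {u // u ∈ S}).card : ℝ) * (checkFailures N {u // u ∈ Sᶜ}).card ≤
        p * (2 ^ S.card.choose 2 * 2 ^ Sᶜ.card.choose 2)) :
    (Finset.card {G ∈ checkFailures N V | oddVerts G = S} : ℝ) ≤
      2 ^ (Fintype.card V - 1).choose 2 * (p + cutError S * (1 - p)) := by
  have : Nonempty V := Fintype.card_pos_iff.1 (by omega)
  have htot : (Finset.card {G : SimpleGraph V | oddVerts G = S} : ℝ) ≤
      2 ^ (Fintype.card V - 1).choose 2 := by
    exact_mod_cast card_oddVerts_eq_le S (Classical.arbitrary V)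
  set t : ℝ := 2 ^ (Fintype.card V - 1).choose 2 with ht
  have ht0 : 0 ≤ t := by positivity
  -- If the error is at least `1` the bound is trivial. This disposes of all parts with at most six
  -- vertices, including those on which the algorithm gives up.
  by_cases hθ : 1 ≤ cutError S
  · have h1 : (Finset.card {G ∈ checkFailures N V | oddVerts G = S} : ℝ) ≤
        Finset.card {G : SimpleGraph V | oddVerts G = S} := by
      exact_mod_cast Finset.card_le_card (Finset.filter_subset_filter _ (Finset.subset_univ _))
    refine (h1.trans htot).trans (le_mul_of_one_le_right ht0 ?_)
    nlinarith
  · have hsize : 7 ≤ S.card ∧ 7 ≤ Sᶜ.card := by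
      by_contra h
      exact hθ (one_le_cutError hV (by omega))
    have h1 := card_checkFailures_filter_le_add hN (S := S) (by omega) (by omega)
    set BF := Finset.card {G : SimpleGraph V | oddVerts G = S ∧
      checkFreeDLA N (inducedOn G S) = false ∧ checkFreeDLA N (inducedOn G Sᶜ) = false} with hBF
    set Q := Finset.card {G : SimpleGraph V | oddVerts G = S ∧
      ¬ (checkFreeDLA N (inducedOn G S) = false ∧ checkFreeDLA N (inducedOn G Sᶜ) = false)} with hQ
    have h2 : BF + Q = Finset.card {G : SimpleGraph V | oddVerts G = S} := by
      rw [← Finset.card_filter_add_card_filter_not (s := {G : SimpleGraph V | oddVerts G = S})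
        fun G : SimpleGraph V =>
        checkFreeDLA N (inducedOn G S) = false ∧ checkFreeDLA N (inducedOn G Sᶜ) = false,
        Finset.filter_filter, Finset.filter_filter]
    have h2' : (BF : ℝ) + Q ≤ t := by
      refine le_trans (le_of_eq ?_) htot
      exact_mod_cast h2
    obtain ⟨s, hs⟩ := Finset.card_pos.1 (show 0 < S.card by omega)
    obtain ⟨w, hw⟩ := Finset.card_pos.1 (show 0 < Sᶜ.card by omega)
    have h3 := card_oddVerts_eq_and_inducedOn_le S hs hw
      (fun H => checkFreeDLA N H = false) (fun H => checkFreeDLA N H = false)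
    have h4 : (BF : ℝ) ≤ p * t := by
      have h5 : BF ≤ (checkFailures N {u // u ∈ S}).card *
          ((checkFailures N {u // u ∈ Sᶜ}).card * 2 ^ ((S.card - 1) * (Sᶜ.card - 1))) := by
        convert h3 using 3
        · rw [checkFailures]; congr!
        · rw [checkFailures]; congr!
      have h6 := (Nat.cast_le (α := ℝ)).2 h5
      have h7 := hp hsize.1 hsize.2
      have h8 : t = 2 ^ S.card.choose 2 * 2 ^ Sᶜ.card.choose 2 *
          2 ^ ((S.card - 1) * (Sᶜ.card - 1)) := by
        rw [ht, ← Finset.card_add_card_compl S,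
          ← choose_two_add_choose_two _ _ (by omega) (by omega), pow_add, pow_add, mul_assoc]
      rw [h8]
      push_cast at h6
      generalize ((checkFailures N {u // u ∈ S}).card : ℝ) = x at h6 h7
      generalize ((checkFailures N {u // u ∈ Sᶜ}).card : ℝ) = y at h6 h7
      rw [← mul_assoc] at h6 ⊢
      exact h6.trans (mul_le_mul_of_nonneg_right h7 (by positivity))
    have hθ0 : 0 ≤ cutError S := by rw [cutError]; positivity
    push Not at hθ
    -- With `θ = cutError S`: `BF + θ Q ≤ (1 - θ) BF + θ t ≤ t (p + θ (1 - p))`, using `BF + Q ≤ t`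
    -- and `BF ≤ p t`.
    nlinarith [mul_le_mul_of_nonneg_left h2' hθ0,
      mul_le_mul_of_nonneg_left h4 (sub_nonneg.2 hθ.le)]

theorem sum_cutError (V : Type) [Fintype V] [DecidableEq V] :
    ∑ S : Finset V, cutError S = 4 * (Fintype.card V : ℝ) ^ 2 * (3 / 2) ^ Fintype.card V := by
  have h1 := Finset.sum_pow_mul_eq_add_pow (1 / 2 : ℝ) 1 (Finset.univ : Finset V)
  have h2 := Finset.sum_pow_mul_eq_add_pow (1 : ℝ) (1 / 2) (Finset.univ : Finset V)
  simp only [Finset.powerset_univ, one_pow, mul_one, one_mul, Finset.card_univ] at h1 h2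
  simp only [cutError, Finset.card_compl]
  rw [← Finset.mul_sum, Finset.sum_add_distrib, h1, h2]
  norm_num
  ring

-- Sum over the possible sets `V_o`, which have even size; there are `2 ^ (n - 1)` of these. The
-- errors, summed over all subsets, give `4n²(3/2)^n` by the binomial theorem, which normalizes to
-- `8n²(3/4)^n`.
open Classical in
theorem card_checkFailures_le {N : ℕ} (hN : N < Fintype.card V) (hV : 7 ≤ Fintype.card V)
    {p : ℝ} (hp1 : p ≤ 1)
    (hp : ∀ S : Finset V, 7 ≤ S.card → 7 ≤ Sᶜ.card →
      ((checkFailures N {u // u ∈ S}).card : ℝ) * (checkFailures N {u // u ∈ Sᶜ}).card ≤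
        p * (2 ^ S.card.choose 2 * 2 ^ Sᶜ.card.choose 2)) :
    ((checkFailures N V).card : ℝ) ≤ 2 ^ (Fintype.card V).choose 2 *
      (p + (1 - p) * (8 * (Fintype.card V : ℝ) ^ 2 * (3 / 4) ^ Fintype.card V)) := by
  have : Nonempty V := Fintype.card_pos_iff.1 (by omega)
  set n := Fintype.card V with hn
  set t : ℝ := 2 ^ (n - 1).choose 2 with ht
  have ht2 : t * 2 ^ n = 2 * 2 ^ n.choose 2 := by
    obtain ⟨m, hm⟩ := Nat.exists_eq_add_of_le' (show 1 ≤ n by omega)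
    rw [ht, hm, Nat.add_sub_cancel, Nat.choose_succ_succ' m 1, Nat.choose_one_right, pow_add,
      pow_add]
    ring
  set E : Finset (Finset V) := {S ∈ Finset.univ.powerset | Even S.card} with hE
  have hEcard : (2 : ℝ) * E.card = 2 ^ n := by
    have := card_powerset_filter_even (Finset.univ_nonempty (α := V))
    rw [Finset.card_univ] at this
    exact_mod_cast this
  have hmaps : ∀ G ∈ checkFailures N V, oddVerts G ∈ E := by
    intro G _
    rw [hE, Finset.mem_filter]
    exact ⟨by simp, G.even_card_odd_degree_vertices⟩
  have hsumE : ∑ S ∈ E, cutError S ≤ 4 * (n : ℝ) ^ 2 * (3 / 2) ^ n := by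
    rw [hn, ← sum_cutError V]
    exact Finset.sum_le_sum_of_subset_of_nonneg (Finset.subset_univ _) fun S _ _ => by
      rw [cutError]; positivity
  have h34 : (3 / 2 : ℝ) ^ n = 2 ^ n * (3 / 4) ^ n := by rw [← mul_pow]; norm_num
  calc ((checkFailures N V).card : ℝ)
      = ∑ S ∈ E, (Finset.card {G ∈ checkFailures N V | oddVerts G = S} : ℝ) := by
        exact_mod_cast Finset.card_eq_sum_card_fiberwise hmaps
    _ ≤ ∑ S ∈ E, t * (p + cutError S * (1 - p)) := Finset.sum_le_sum fun S _ =>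
        card_checkFailures_filter_le hN hV S hp1 (hp S)
    _ = t * (E.card * p + (∑ S ∈ E, cutError S) * (1 - p)) := by
        rw [← Finset.mul_sum, Finset.sum_add_distrib, Finset.sum_const, nsmul_eq_mul,
          Finset.sum_mul]
    _ ≤ t * (E.card * p + (4 * (n : ℝ) ^ 2 * (3 / 2) ^ n) * (1 - p)) := by
        gcongr
    _ = _ := by
        have h5 : t * E.card = 2 ^ n.choose 2 := by
          linear_combination (t / 2) * hEcard + (1 / 2) * ht2
        rw [h34]
        linear_combination p * h5 + (4 * (n : ℝ) ^ 2 * (3 / 4) ^ n * (1 - p)) * ht2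

/-- The gain from `p = exp(-c(n+2))` to `exp(-c(n+1))` is at least `c p`, while `1 - p ≤ c(n+2)`.
The factor `c` cancels, so the size condition on `n` does not depend on `c`. -/
theorem error_le_exp {n : ℕ} {c : ℝ} (hc0 : 0 ≤ c) (hc1 : c ≤ 1 / 10)
    (hn : 8 * (n : ℝ) ^ 2 * (n + 2) * (3 / 4) ^ n ≤ (9 / 10) ^ (n + 2)) :
    Real.exp (-(c * (n + 2))) + (1 - Real.exp (-(c * (n + 2)))) *
      (8 * (n : ℝ) ^ 2 * (3 / 4) ^ n) ≤ Real.exp (-(c * (n + 1))) := by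
  set p := Real.exp (-(c * (n + 2))) with hp
  have h1 : (9 / 10 : ℝ) ^ (n + 2) ≤ p := by
    have h2 : (9 / 10 : ℝ) ≤ Real.exp (-c) := by
      linarith [Real.add_one_le_exp (-c)]
    calc (9 / 10 : ℝ) ^ (n + 2) ≤ Real.exp (-c) ^ (n + 2) := by gcongr
      _ = p := by rw [← Real.exp_nat_mul, hp]; congr 1; push_cast; ring
  have h2 : 1 - p ≤ c * (n + 2) := by linarith [Real.add_one_le_exp (-(c * (n + 2)))]
  have h3 : p * (1 + c) ≤ Real.exp (-(c * (n + 1))) := by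
    have : Real.exp (-(c * (n + 1))) = p * Real.exp c := by
      rw [hp, ← Real.exp_add]; congr 1; ring
    rw [this]
    have := Real.add_one_le_exp c
    gcongr
    linarith
  have h4 : (1 - p) * (8 * (n : ℝ) ^ 2 * (3 / 4) ^ n) ≤ c * p := by
    calc (1 - p) * (8 * (n : ℝ) ^ 2 * (3 / 4) ^ n)
        ≤ c * (n + 2) * (8 * (n : ℝ) ^ 2 * (3 / 4) ^ n) := by gcongr
      _ = c * (8 * (n : ℝ) ^ 2 * (n + 2) * (3 / 4) ^ n) := by ring
      _ ≤ c * p := by gcongr; exact hn.trans h1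
  linarith

theorem exists_error_threshold : ∃ N : ℕ, 7 ≤ N ∧ ∀ n : ℕ, N < n →
    8 * (n : ℝ) ^ 2 * (n + 2) * (3 / 4) ^ n ≤ (9 / 10) ^ (n + 2) := by
  have h1 : ∀ᶠ n : ℕ in Filter.atTop, (n : ℝ) ^ 3 * (5 / 6) ^ n < 3 / 100 :=
    (tendsto_pow_const_mul_const_pow_of_abs_lt_one 3
      (by rw [abs_of_pos] <;> norm_num)).eventually_lt_const (by norm_num)
  obtain ⟨N, hN⟩ := Filter.eventually_atTop.1 h1
  refine ⟨max N 7, le_max_right _ _, fun n hn => ?_⟩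
  have h2 := hN n (by omega)
  have hn1 : (1 : ℝ) ≤ n := by exact_mod_cast (show 1 ≤ n by omega)
  -- Splitting `3/4 = (5/6)(9/10)` lets `(5/6)^n` absorb the cubic factor; then `24 · 3/100 ≤
  -- (9/10)²`.
  have h3 : (3 / 4 : ℝ) ^ n = (5 / 6) ^ n * (9 / 10) ^ n := by rw [← mul_pow]; norm_num
  calc 8 * (n : ℝ) ^ 2 * (n + 2) * (3 / 4) ^ n
      ≤ 8 * (n : ℝ) ^ 2 * (3 * n) * (3 / 4) ^ n := by gcongr; linarith
    _ = 24 * ((n : ℝ) ^ 3 * (5 / 6) ^ n) * (9 / 10) ^ n := by rw [h3]; ring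
    _ ≤ 24 * (3 / 100) * (9 / 10) ^ n := by gcongr
    _ ≤ (9 / 10) ^ (n + 2) := by
        rw [pow_add, mul_comm]
        gcongr
        norm_num

theorem card_checkFailures_lt {N : ℕ} (hN : Fintype.card V ≤ N) (hV : 7 ≤ Fintype.card V) :
    (checkFailures N V).card + 1 ≤ 2 ^ (Fintype.card V).choose 2 := by
  classical
  rw [← card_simpleGraph, ← Finset.card_univ, Nat.add_one_le_iff]
  refine Finset.card_lt_card (Finset.ssubset_univ_iff.2 fun h => ?_)
  have h1 := hasFreeDLA_spider hV (Fintype.equivFin V)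
  have h2 := Finset.eq_univ_iff_forall.1 h
    (spider (Fintype.card V) (by omega) fun v => (Fintype.equivFin V v : ℕ))
  rw [checkFailures, Finset.mem_filter_univ] at h2
  unfold checkFreeDLA at h2
  rw [if_pos hN] at h2
  simp at h2
  exact h2 h1

/-- The exponent `n + 1` instead of `n` makes the induction close: two parts contribute two extra
units, one more than needed. -/
theorem exists_card_checkFailures_le : ∃ N : ℕ, 0 < N ∧ ∃ c : ℝ, 0 < c ∧
    ∀ (n : ℕ), 7 ≤ n → ∀ (V : Type) [Fintype V] [DecidableEq V], Fintype.card V = n →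
      ((checkFailures N V).card : ℝ) ≤ 2 ^ n.choose 2 * Real.exp (-(c * (n + 1))) := by
  obtain ⟨N, hN7, hN⟩ := exists_error_threshold
  -- `N` is fixed before `c`. The second term makes `c(n+1) ≤ 2^(-n.choose 2)` for all `n ≤ N`, so
  -- the single graph known to succeed at each such size gives the base case.
  set c : ℝ := min (1 / 10) ((1 / 2) ^ N.choose 2 / (N + 1)) with hc
  have hc0 : 0 < c := lt_min (by norm_num) (by positivity)
  have hc1 : c ≤ 1 / 10 := min_le_left _ _
  have hc2 : c * (N + 1) ≤ (1 / 2) ^ N.choose 2 := by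
    rw [← le_div_iff₀ (by positivity)]
    exact min_le_right _ _
  refine ⟨N, by omega, c, hc0, fun n => ?_⟩
  induction n using Nat.strong_induction_on with
  | _ n ih =>
  intro hn V _ _ hV
  rcases le_or_gt n N with hnN | hnN
  · have h1 : ((checkFailures N V).card : ℝ) + 1 ≤ 2 ^ n.choose 2 := by
      rw [← hV]
      exact_mod_cast card_checkFailures_lt (by omega) (by omega)
    have h2 : 1 - (1 / 2 : ℝ) ^ n.choose 2 ≤ Real.exp (-(c * (n + 1))) := by
      have h3 : c * (n + 1) ≤ (1 / 2) ^ n.choose 2 := by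
        calc c * (n + 1) ≤ c * (N + 1) := by gcongr
          _ ≤ (1 / 2) ^ N.choose 2 := hc2
          _ ≤ (1 / 2) ^ n.choose 2 := pow_le_pow_of_le_one (by norm_num) (by norm_num)
              (Nat.choose_le_choose 2 hnN)
      linarith [Real.add_one_le_exp (-(c * (n + 1)))]
    calc ((checkFailures N V).card : ℝ) ≤ 2 ^ n.choose 2 - 1 := by linarith
      _ = 2 ^ n.choose 2 * (1 - (1 / 2) ^ n.choose 2) := by
          rw [mul_sub, mul_one, ← mul_pow]; norm_num
      _ ≤ _ := by gcongr
  · have h1 := card_checkFailures_le (V := V) (N := N) (by omega) (by omega)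
      (p := Real.exp (-(c * (n + 2))))
      (Real.exp_le_one_iff.2 (by have : (0 : ℝ) ≤ c * (n + 2) := by positivity
                                 linarith)) ?_
    · rw [hV] at h1
      refine h1.trans ?_
      gcongr
      exact error_le_exp hc0.le hc1 (hN n hnN)
    · intro S hS hSc
      have hab := Finset.card_add_card_compl S
      rw [hV] at hab
      have e1 := ih S.card (by omega) hS {u // u ∈ S} (Fintype.card_coe S)
      have e2 := ih Sᶜ.card (by omega) hSc {u // u ∈ Sᶜ} (Fintype.card_coe Sᶜ)
      have hexp : Real.exp (-(c * (n + 2))) =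
          Real.exp (-(c * (S.card + 1))) * Real.exp (-(c * (Sᶜ.card + 1))) := by
        rw [← Real.exp_add, ← hab]; congr 1; push_cast; ring
      rw [hexp]
      refine (mul_le_mul e1 e2 (Nat.cast_nonneg _) (by positivity)).trans_eq ?_
      ring

end Recursion

theorem mainTheorem12 :
    (∀ (V : Type*) [Fintype V] [DecidableEq V] (G : SimpleGraph V) (N : ℕ), 0 < N →
      checkFreeDLA N G = true → HasFreeDLA G) ∧
    ∃ N : ℕ, 0 < N ∧ ∃ c : ℝ, 0 < c ∧ ∀ n : ℕ, 7 ≤ n →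
      1 - Real.exp (-(c * n)) ≤ (erHalf n).real {G | checkFreeDLA N G = true} ∧
      1 - Real.exp (-(c * n)) ≤ (erHalf n).real {G | HasFreeDLA G} := by
  refine ⟨fun V _ _ G N _ h => hasFreeDLA_of_checkFreeDLA N G h, ?_⟩
  obtain ⟨N, hN, c, hc, h⟩ := exists_card_checkFailures_le
  refine ⟨N, hN, c, hc, fun n hn => ?_⟩
  have : IsProbabilityMeasure (erHalf n) := by unfold erHalf; infer_instance
  have h1 : 1 - Real.exp (-(c * n)) ≤ (erHalf n).real {G | checkFreeDLA N G = true} := by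
    have h2 : (erHalf n).real (checkFailures N (Fin n)) ≤ Real.exp (-(c * n)) := by
      rw [erHalf, binomialRandom_half_real, Fintype.card_fin]
      have h3 := h n hn (Fin n) (Fintype.card_fin n)
      calc _ ≤ 2 ^ n.choose 2 * Real.exp (-(c * (n + 1))) * (1 / 2) ^ n.choose 2 := by gcongr
        _ = Real.exp (-(c * (n + 1))) * (2 * (1 / 2)) ^ n.choose 2 := by rw [mul_pow]; ring
        _ ≤ Real.exp (-(c * n)) := by
            norm_num
            linarith
    have h4 : ({G | checkFreeDLA N G = true} : Set (SimpleGraph (Fin n))) =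
        (checkFailures N (Fin n) : Set (SimpleGraph (Fin n)))ᶜ := by
      ext G
      simp [checkFailures]
    rw [h4, probReal_compl_eq_one_sub (Finset.measurableSet _)]
    linarith
  exact ⟨h1, h1.trans (measureReal_mono fun G hG => hasFreeDLA_of_checkFreeDLA N G hG)⟩
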